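/- **Definitions.** A $k$-graph is a countable category $\Lambda$ with a map $d:\Lambda\to\mathbb{N}^k$ that carries composition to addition and has the factorisation property: if $d(\lambda)=m+n$, then $\lambda=\mu\nu$ for unique $\mu,\nu$ with $d(\mu)=m$ and $d(\nu)=n$. Write $\Lambda^n=d^{-1}(n)$; then $\Lambda^0$ is the set of identity morphisms (vertices), and $r,s:\Lambda\to\Lambda^0$ denote codomain and domain. Put $v\Lambda^n=\{\lambda\in\Lambda^n: r(\lambda)=v\}$ and $v\Lambda w=\{\lambda\in\Lambda : r(\lambda)=v,\ s(\lambda)=w\}$. $\Lambda$ is row-finite if every $v\Lambda^n$ is finite, and has no sources if every $v\Lambda^n$ is nonempty. An infinite path is a map $x:\{(m,n)\in\mathbb{N}^k\times\mathbb{N}^k: m\le n\}\to\Lambda$ with $d(x(m,n))=n-m$ and $x(m,n)x(n,p)=x(m,p)$; $v\Lambda^\infty$ is the set of those with $x(0,0)=v$, and $\sigma^p(x)(m,n)=x(m+p,n+p)$. For $\lambda\in v\Lambda v$ with all coordinates of $d(\lambda)$ nonzero, $\lambda^\infty$ is the infinite path $x$ with $x(0,l\cdot d(\lambda))=\lambda^l$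 for all $l\in\mathbb{N}$. $\Lambda$ is cofinal if for every vertex $v$ and infinite path $x$ there is $n\in\mathbb{N}^k$ with $v\Lambda x(n,n)\neq\emptyset$. $\Lambda$ is aperiodic if for every vertex $v$ and all $m\ne n$ in $\mathbb{N}^k$ there is $x\in v\Lambda^\infty$ with $\sigma^m(x)\neq\sigma^n(x)$. In a $2$-graph let $e_1,e_2$ be the generators of $\mathbb{N}^2$. A blue cycle is a path $\lambda=\lambda_1\cdots\lambda_n$ with $n\ge1$, all $\lambda_i\in\Lambda^{e_1}$, $r(\lambda)=s(\lambda)$, and $s(\lambda_i)\ne s(\lambda_j)$ for $i\neq j$; it has no blue entrance if $r(\lambda_i)\Lambda^{e_1}=\{\lambda_i\}$ for all $i$. Red cycles and red entrances are defined in the same way with $e_2$. For $\Lambda$ row-finite with no sources, $C^*(\Lambda)$ is the universal $C^*$-algebra generated by elements $s_\lambda$ ($\lambda\in\Lambda$) such that the $p_v:=s_v$ ($v\in\Lambda^0$) are mutually orthogonal projections, $s_\lambda s_\mu=s_{\lambda\mu}$ if $s(\lambda)=r(\mu)$, $s_\lambda^*s_\lambda=p_{s(\lambda)}$, and $p_v=\sum_{\lambda\in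 v\Lambda^n}s_\lambda s_\lambda^*$ for all $v$ and $n$. A projection $p\in A$ is full if the closed linear span of $ApA$ is $A$. $C^*$-algebras $A,B$ are stably isomorphic if $A\otimes\mathcal{K}\cong B\otimes\mathcal{K}$, where $\mathcal{K}$ is the algebra of compact operators on $\ell^2(\mathbb{N})$. An AF algebra is the closure of the union of an increasing sequence of finite-dimensional $*$-subalgebras, and a $C^*$-algebra is AF-embeddable if it has an injective $*$-homomorphism into an AF algebra. **Proposition 6.1.** Let $\Lambda$ be a row-finite, cofinal $2$-graph with no sources. Suppose that $\Lambda$ contains a blue cycle with no blue entrance and a red cycle with no red entrance. Then there exist a vertex $v$, a blue cycle $\zeta\in v\Lambda v$ and a red cycle $\xi\in v\Lambda v$ such that $v\Lambda^\infty=\{(\zeta\xi)^\infty\}$, $p_vC^*(\Lambda)p_v\cong C(\mathbb{T}^2)$, and the projection $p_v$ is full. Moreover, $C^*(\Lambda)$ is stably isomorphic to $C(\mathbb{T}^2)$, $\Lambda$ is not aperiodic, and $C^*(\Lambda)$ is AF-embeddable and not simple. -/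

import Mathlib

open CategoryTheory
open scoped ENNReal

universe u v w

noncomputable section

/-! ### Higher-rank graphs

The objects of the category are the vertices.  A morphism `f : w ⟶ v` is a path with source `w` and
range `v`; the path written `μν` by juxtaposition (first `ν`, then `μ`) is `ν ≫ μ`. -/

/-- A `k`-graph: a countable category with a degree functor to `ℕ^k` satisfying the factorisation
property. -/
structure KGraph (k : ℕ) (V : Type u) [Category.{v} V] where
  countable_vertices : Countable V
  countable_paths : ∀ w v : V, Countable (w ⟶ v)
  /-- the degree map -/
  d : ∀ {w v : V}, (w ⟶ v) → (Fin k → ℕ)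
  d_comp : ∀ {u w v : V} (ν : u ⟶ w) (μ : w ⟶ v), d (ν ≫ μ) = d μ + d ν
  factorisation : ∀ {w v : V} (f : w ⟶ v) (m n : Fin k → ℕ), d f = m + n →
    ∃! p : Σ u : V, (u ⟶ v) × (w ⟶ u), d p.2.1 = m ∧ d p.2.2 = n ∧ p.2.2 ≫ p.2.1 = f

namespace KGraph

variable {k : ℕ} {V : Type u} [Category.{v} V] (Λ : KGraph k V)

/-- The set `vΛⁿ` of paths of degree `n` with range `v` (the first component is the source). -/
def PathsFrom (v : V) (n : Fin k → ℕ) : Type (max u v) :=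
  {p : Σ w : V, (w ⟶ v) // Λ.d p.2 = n}

/-- `vΛⁿ` is finite for all `v` and `n`. -/
def RowFinite : Prop := ∀ v n, Finite (Λ.PathsFrom v n)

/-- `vΛⁿ` is nonempty for all `v` and `n`. -/
def NoSources : Prop := ∀ v n, Nonempty (Λ.PathsFrom v n)

/-! ### Cycles in the coordinate graphs -/

/-- The `i`-th standard generator of `ℕ^k`. -/
def basisDegree (i : Fin k) : Fin k → ℕ := Pi.single i 1

/-- `f = μ e ν` with `d(μ) = j eᵢ` and `d(e) = eᵢ`.  For a path `f = λ₁ ⋯ λₙ` with all `λ_l ∈ Λ^{eᵢ}`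
this says that `j < n` and `e = λ_{j+1}`. -/
def IsEdgeAt (i : Fin k) {w v : V} (f : w ⟶ v) (j : ℕ) {b a : V} (e : b ⟶ a) : Prop :=
  ∃ (μ : a ⟶ v) (ν : w ⟶ b),
    Λ.d μ = j • basisDegree i ∧ Λ.d e = basisDegree i ∧ ν ≫ e ≫ μ = f

/-- A cycle of colour `i`: a closed path `λ₁ ⋯ λₙ` with `n ≥ 1` and all `λ_l ∈ Λ^{eᵢ}`, such that the
sources `s(λ_l)` are pairwise distinct. -/
def IsCycle (i : Fin k) {v : V} (f : v ⟶ v) : Prop :=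
  (∃ n : ℕ, n ≠ 0 ∧ Λ.d f = n • basisDegree i) ∧
  ∀ (j j' : ℕ) (b a a' : V) (e : b ⟶ a) (e' : b ⟶ a'),
    Λ.IsEdgeAt i f j e → Λ.IsEdgeAt i f j' e' → j = j'

/-- The path `λ₁ ⋯ λₙ` of colour `i` has no entrance of colour `i`: `r(λ_l)Λ^{eᵢ} = {λ_l}` for all
`l`. -/
def HasNoEntrance (i : Fin k) {v : V} (f : v ⟶ v) : Prop :=
  ∀ (j : ℕ) (b a : V) (e : b ⟶ a), Λ.IsEdgeAt i f j e →
    ∀ (c : V) (g : c ⟶ a), Λ.d g = basisDegree i →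
      (⟨c, g⟩ : Σ w : V, (w ⟶ a)) = ⟨b, e⟩

/-! ### Infinite paths, cofinality and aperiodicity -/

/-- An infinite path: `x(m, n) = path m n _` for `m ≤ n`, and `vert n` is the vertex `x(n, n)`. -/
@[ext]
structure InfinitePath where
  vert : (Fin k → ℕ) → V
  path : ∀ m n : Fin k → ℕ, m ≤ n → (vert n ⟶ vert m)
  d_path : ∀ m n h, Λ.d (path m n h) = n - m
  path_comp : ∀ m n p (hmn : m ≤ n) (hnp : n ≤ p),
    path n p hnp ≫ path m n hmn = path m p (hmn.trans hnp)

variable {Λ} in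
/-- The shift `σ^p(x)(m, n) = x(m + p, n + p)`. -/
def InfinitePath.shift (x : Λ.InfinitePath) (p : Fin k → ℕ) : Λ.InfinitePath where
  vert n := x.vert (n + p)
  path m n h := x.path (m + p) (n + p) (add_le_add_left h p)
  d_path m n h := by rw [x.d_path]; exact add_tsub_add_eq_tsub_right n p m
  path_comp m n q hmn hnq := x.path_comp _ _ _ _ _

/-- The set `vΛ^∞` of infinite paths with range `v`. -/
def infinitePathsFrom (v : V) : Set Λ.InfinitePath := {x | x.vert 0 = v}

/-- The `l`-fold product `f^l` of a closed path. -/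
def closedPathPow {v : V} (f : v ⟶ v) : ℕ → (v ⟶ v)
  | 0 => 𝟙 v
  | l + 1 => closedPathPow f l ≫ f

variable {Λ} in
/-- `x = f^∞` for a closed path `f`: the initial segment `x(0, l·d(f))` is the `l`-fold product
`f^l`, for every `l`; when all coordinates of `d(f)` are nonzero this determines `x`.  (Equality of arrows includes equality of sources and ranges.) -/
def InfinitePath.IsInfinitePower (x : Λ.InfinitePath) {v : V} (f : v ⟶ v) : Prop :=
  ∀ l : ℕ, Arrow.mk (x.path 0 (l • Λ.d f) zero_le) = Arrow.mk (closedPathPow f l)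

/-- Every vertex is the range of a path starting on any given infinite path. -/
def Cofinal : Prop :=
  ∀ (v : V) (x : Λ.InfinitePath), ∃ n, Nonempty (x.vert n ⟶ v)

/-- Aperiodicity: no vertex has local periodicity, i.e. for every vertex `v` and all `m ≠ n` in `ℕ^k`
there is `x ∈ vΛ^∞` with `σ^m(x) ≠ σ^n(x)`. -/
def Aperiodic : Prop :=
  ∀ (v : V) (m n : Fin k → ℕ), m ≠ n → ∃ x ∈ Λ.infinitePathsFrom v, x.shift m ≠ x.shift n

/-! ### The C*-algebra of a higher-rank graph -/

/-- A Cuntz--Krieger `Λ`-family in a C*-algebra. -/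
structure CKFamily (A : Type w) [NonUnitalCStarAlgebra A] where
  S : ∀ {w v : V}, (w ⟶ v) → A
  isStarProjection : ∀ v : V, IsStarProjection (S (𝟙 v))
  orthogonal : ∀ v w : V, v ≠ w → S (𝟙 v) * S (𝟙 w) = 0
  mul : ∀ {u w v : V} (μ : w ⟶ v) (ν : u ⟶ w), S μ * S ν = S (ν ≫ μ)
  star_mul_self : ∀ {w v : V} (μ : w ⟶ v), star (S μ) * S μ = S (𝟙 w)
  sum_eq : ∀ (v : V) (n : Fin k → ℕ) [Fintype (Λ.PathsFrom v n)],
    S (𝟙 v) = ∑ p : Λ.PathsFrom v n, S p.1.2 * star (S p.1.2)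

variable {Λ} in
theorem CKFamily.norm_le_one {A : Type w} [NonUnitalCStarAlgebra A] (F : Λ.CKFamily A) {w v : V}
    (μ : w ⟶ v) : ‖F.S μ‖ ≤ 1 := by
  have hp := F.isStarProjection w
  have h1 : ‖F.S (𝟙 w)‖ ≤ 1 := by
    have h := CStarRing.norm_star_mul_self (x := F.S (𝟙 w))
    rw [hp.isSelfAdjoint.star_eq, hp.isIdempotentElem.eq] at h
    nlinarith [norm_nonneg (F.S (𝟙 w))]
  have h2 := CStarRing.norm_star_mul_self (x := F.S μ)
  rw [F.star_mul_self] at h2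
  nlinarith [norm_nonneg (F.S μ)]

/-- A Cuntz--Krieger `Λ`-family together with the C*-algebra that contains it.  (A family consists of
countably many elements, so it generates a separable C*-algebra, which is isomorphic to one in the
lowest universe.) -/
structure Representation where
  Carrier : Type
  [inst : NonUnitalCStarAlgebra Carrier]
  family : Λ.CKFamily Carrier

attribute [instance] Representation.inst

/-- The C*-algebra of bounded families indexed by all representations, with the supremum norm. -/
abbrev BoundedFamilies : Type (max u v 1) :=
  lp (fun π : Λ.Representation => π.Carrier) ∞

/-- The element of the product whose component at a representation is the image of the path. -/
def generator {w v : V} (μ : w ⟶ v) : Λ.BoundedFamilies :=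
  ⟨fun π => π.family.S μ, by
    refine memℓp_infty ⟨1, ?_⟩
    rintro _ ⟨π, rfl⟩
    exact π.family.norm_le_one μ⟩

/-- The closed *-subalgebra generated by the elements `generator μ`. -/
def universalSubalgebra : NonUnitalStarSubalgebra ℂ Λ.BoundedFamilies :=
  (NonUnitalStarAlgebra.adjoin ℂ
    {a : Λ.BoundedFamilies | ∃ (w v : V) (μ : w ⟶ v), a = Λ.generator μ}).topologicalClosure

/-- `C*(Λ)`, the universal C*-algebra generated by a Cuntz--Krieger `Λ`-family: the completion of the
*-algebra generated by the symbols `s_μ` in the supremum of the seminorms `a ↦ ‖π(a)‖`, where `π` runs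
over all Cuntz--Krieger families. -/
def CStar : Type (max u v 1) := Λ.universalSubalgebra

instance : NonUnitalCStarAlgebra Λ.CStar :=
  NonUnitalStarSubalgebra.nonUnitalCStarAlgebra Λ.universalSubalgebra
    (h_closed := NonUnitalStarSubalgebra.isClosed_topologicalClosure _)

/-- The generating partial isometry `s_μ ∈ C*(Λ)`. -/
def s {w v : V} (μ : w ⟶ v) : Λ.CStar :=
  ⟨Λ.generator μ, NonUnitalStarSubalgebra.le_topologicalClosure _
    (NonUnitalStarAlgebra.subset_adjoin ℂ _ ⟨w, v, μ, rfl⟩)⟩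

/-- The vertex projection `p_v = s_v`. -/
def p (v : V) : Λ.CStar := Λ.s (𝟙 v)

theorem isStarProjection_p (v : V) : IsStarProjection (Λ.p v) := by
  constructor
  · exact Subtype.ext (lp.ext (funext fun π => (π.family.isStarProjection v).isIdempotentElem.eq))
  · exact Subtype.ext (lp.ext (funext fun π => (π.family.isStarProjection v).isSelfAdjoint.star_eq))

end KGraph

/-! ### C*-algebraic notions -/

section CStarNotions

/-- The corner `pAp` of a projection `p`. -/
def cornerSubalgebra {A : Type u} [NonUnitalCStarAlgebra A] (p : A) (hp : IsStarProjection p) :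
    NonUnitalStarSubalgebra ℂ A where
  carrier := Set.range fun a => p * a * p
  zero_mem' := ⟨0, by simp⟩
  add_mem' := by
    rintro _ _ ⟨a, rfl⟩ ⟨b, rfl⟩
    exact ⟨a + b, by simp [mul_add, add_mul]⟩
  mul_mem' := by
    rintro _ _ ⟨a, rfl⟩ ⟨b, rfl⟩
    exact ⟨a * p * p * b, by simp only [mul_assoc]⟩
  smul_mem' := by
    rintro c _ ⟨a, rfl⟩
    exact ⟨c • a, by simp [mul_smul_comm, smul_mul_assoc]⟩
  star_mem' := by
    rintro _ ⟨a, rfl⟩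
    exact ⟨star a, by simp [hp.isSelfAdjoint.star_eq, mul_assoc]⟩

/-- A projection `p` of `A` is full: the closed linear span of `ApA` is all of `A`. -/
def IsFullElement {A : Type u} [NonUnitalCStarAlgebra A] (p : A) : Prop :=
  Dense (Submodule.span ℂ {x : A | ∃ a b : A, x = a * p * b} : Set A)

/-- A simple C*-algebra: nonzero, with no closed two-sided ideals besides `0` and itself. -/
def IsSimpleCStar (A : Type u) [NonUnitalCStarAlgebra A] : Prop :=
  Nontrivial A ∧ ∀ I : TwoSidedIdeal A, IsClosed (I : Set A) → I = ⊥ ∨ I = ⊤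

/-- An AF algebra: the closure of an increasing union of a sequence of finite-dimensional
*-subalgebras. -/
def IsAF (A : Type u) [NonUnitalCStarAlgebra A] : Prop :=
  ∃ F : ℕ → NonUnitalStarSubalgebra ℂ A, Monotone F ∧
    (∀ n, FiniteDimensional ℂ (F n).toSubmodule) ∧ Dense (⋃ n, (F n : Set A))

/-- There is an injective *-homomorphism into an AF algebra.  (AF algebras are separable, so up to
isomorphism they all live in the lowest universe.) -/
def AFEmbeddable (A : Type u) [NonUnitalCStarAlgebra A] : Prop :=
  ∃ (B : Type) (_ : NonUnitalCStarAlgebra B), IsAF B ∧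
    ∃ φ : A →⋆ₙₐ[ℂ] B, Function.Injective φ

/-- `D`, with the elements `e i j a` in the role of `a ⊗ E_{ij}`, is the stabilisation `A ⊗ 𝒦`, where
`𝒦` is the algebra of compact operators on `ℓ²(ℕ)` with its matrix units `E_{ij}`.  The relations say
that `(a_{ij}) ↦ ∑ e i j (a_{ij})` defines injective *-homomorphisms `Mₙ(A) → D` compatible with the
inclusions `Mₙ(A) ⊆ Mₙ₊₁(A)` into the upper left corner, and density says that their ranges have dense
union; so `D` is the C*-algebraic inductive limit of the `Mₙ(A)`, that is, `A ⊗ 𝒦`. -/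
structure Stabilisation (A : Type u) [NonUnitalCStarAlgebra A] (D : Type v)
    [NonUnitalCStarAlgebra D] where
  e : ℕ → ℕ → A →ₗ[ℂ] D
  mul_same : ∀ i j l a b, e i j a * e j l b = e i l (a * b)
  mul_ne : ∀ i j j' l a b, j ≠ j' → e i j a * e j' l b = 0
  star_e : ∀ i j a, star (e i j a) = e j i (star a)
  injective : ∀ i j, Function.Injective (e i j)
  dense : Dense (Submodule.span ℂ {x : D | ∃ i j a, x = e i j a} : Set D)

/-- `A ⊗ 𝒦 ≅ B ⊗ 𝒦`. -/
def StablyIsomorphic (A : Type u) [NonUnitalCStarAlgebra A] (B : Type v)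
    [NonUnitalCStarAlgebra B] : Prop :=
  ∃ (D : Type u) (_ : NonUnitalCStarAlgebra D) (E : Type v) (_ : NonUnitalCStarAlgebra E),
    Nonempty (Stabilisation A D) ∧ Nonempty (Stabilisation B E) ∧ Nonempty (D ≃⋆ₐ[ℂ] E)

end CStarNotions

end

/-!
The two cycles force the graph to be periodic. If a closed path `μ` is the only element of `aΛⁿ`,
then for each `m` the equation `f g = μ f'`, with `f, f' ∈ aΛᵐ` and `g ∈ s(f)Λⁿ`, defines a
permutation of the finite set `aΛᵐ` (`KGraph.subsingleton_and_exists_closed`). So every vertex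
from which a cycle without entrance can be reached receives a single edge of its colour and lies
on a closed path of that colour. By cofinality some vertex `v` reaches both cycles. It receives a
single path of each degree, the shortest closed paths of each colour at `v` are the cycles `ζ` and
`ξ`, and cofinality together with row-finiteness shows that all infinite paths run into `v`
(`KGraph.exists_isPeriodicVertex`).

Infinite paths are then encoded by tail classes of paths that start at `v`. Two elements `s_f`,
`s_g` with `f, g` from `v` satisfy `s_f^* s_g = 0` if `f` and `g` belong to different classes, and
otherwise `s_f^* s_g = s_α s_β^*` with closed paths `α, β` at `v`. Hence the elements `s_f s_g^*`
span a dense *-subalgebra (`KGraph.dense_span_S_mul_star`), which shows that `p_v` is full, and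
`C*(Λ)` consists of matrices over the corner at `v` indexed by the infinite paths
(`KGraph.exists_matrixSystem`).

The corner is the closed span of a unitary representation of the group of periods, a subgroup of
finite index in `ℤ²`, so it is commutative and generated by two unitaries. The representation of
`C*(Λ)` on the infinite paths, twisted by characters of the degree, is scalar on the corner and
realises all pairs of values of these unitaries; by Gelfand duality the corner is `C(𝕋²)`
(`KGraph.nonempty_corner_equiv`). The kernel of such a representation is a nontrivial ideal.

For the tensor products with compact operators, `MatrixSystem` axiomatises the elements `a ⊗
E_{ij}`. Injective *-homomorphisms of C*-algebras are isometric, so the norm of a finite matrix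
does not depend on the system; therefore a densely spanning system is universal
(`MatrixSystem.exists_injective_hom`). Stable isomorphism follows by comparing systems over
`C(𝕋²)` with countable index sets, and AF-embeddability by pulling `C(𝕋²)` back to the Cantor
space, over which matrices form an AF algebra.
-/

/-! ### Matrix systems -/

/-- `D` contains a copy `e i j a` of each elementary matrix `a ⊗ E_{ij}` with `a ∈ A`, indexed by
an arbitrary type `ι`.  No density is required, so `D` may be larger than the algebra `A ⊗
𝒦(ℓ²(ι))` that the elements `e i j a` generate. -/
structure MatrixSystem (ι : Type*) (A : Type*) [NonUnitalCStarAlgebra A] (D : Type*)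
    [NonUnitalCStarAlgebra D] where
  e : ι → ι → A →ₗ[ℂ] D
  mul_same : ∀ i j l a b, e i j a * e j l b = e i l (a * b)
  mul_ne : ∀ i j j' l a b, j ≠ j' → e i j a * e j' l b = 0
  star_e : ∀ i j a, star (e i j a) = e j i (star a)
  injective : ∀ i j, Function.Injective (e i j)

namespace MatrixSystem

variable {ι κ : Type*} {A C D D' : Type*} [NonUnitalCStarAlgebra A] [NonUnitalCStarAlgebra C]
  [NonUnitalCStarAlgebra D] [NonUnitalCStarAlgebra D']

/-- The linear span of the elements `e i j a`, a *-subalgebra. -/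
def spanSubalgebra (M : MatrixSystem ι A D) : NonUnitalStarSubalgebra ℂ D where
  toSubmodule := Submodule.span ℂ {x : D | ∃ i j a, x = M.e i j a}
  mul_mem' := by
    intro x y hx hy
    refine Submodule.span_induction₂ (p := fun x y _ _ =>
      x * y ∈ Submodule.span ℂ {x : D | ∃ i j a, x = M.e i j a}) ?_ ?_ ?_ ?_ ?_ ?_ ?_ hx hy
    · rintro _ _ ⟨i, j, a, rfl⟩ ⟨i', j', a', rfl⟩
      by_cases h : j = i'
      · subst h
        rw [M.mul_same]
        exact Submodule.subset_span ⟨_, _, _, rfl⟩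
      · rw [M.mul_ne _ _ _ _ _ _ h]
        exact zero_mem _
    · intro y _; simp
    · intro x _; simp
    · intro x y z _ _ _ h1 h2; rw [add_mul]; exact add_mem h1 h2
    · intro x y z _ _ _ h1 h2; rw [mul_add]; exact add_mem h1 h2
    · intro r x y _ _ h; rw [smul_mul_assoc]; exact Submodule.smul_mem _ r h
    · intro r x y _ _ h; rw [mul_smul_comm]; exact Submodule.smul_mem _ r h
  star_mem' := by
    intro x hx
    refine Submodule.span_induction (p := fun x _ =>
      star x ∈ Submodule.span ℂ {x : D | ∃ i j a, x = M.e i j a}) ?_ ?_ ?_ ?_ hx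
    · rintro _ ⟨i, j, a, rfl⟩
      rw [M.star_e]
      exact Submodule.subset_span ⟨_, _, _, rfl⟩
    · simp
    · intro x y _ _ h1 h2; rw [star_add]; exact add_mem h1 h2
    · intro r x _ h; rw [star_smul]; exact Submodule.smul_mem _ _ h

/-- The elements `e i j a` have dense linear span. -/
def IsDense (M : MatrixSystem ι A D) : Prop :=
  Dense (Submodule.span ℂ {x : D | ∃ i j a, x = M.e i j a} : Set D)

theorem e_mem_spanSubalgebra (M : MatrixSystem ι A D) (i j : ι) (a : A) :
    M.e i j a ∈ M.spanSubalgebra :=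
  Submodule.subset_span ⟨i, j, a, rfl⟩

/-- Change of index set along an injection. -/
def reindex (M : MatrixSystem ι A D) (f : κ → ι) (hf : Function.Injective f) :
    MatrixSystem κ A D where
  e i j := M.e (f i) (f j)
  mul_same _ _ _ := M.mul_same _ _ _
  mul_ne _ _ _ _ _ _ h := M.mul_ne _ _ _ _ _ _ (hf.ne h)
  star_e _ _ := M.star_e _ _
  injective _ _ := M.injective _ _

/-- Change of coefficients along an injective *-homomorphism. -/
def comapCoeff (M : MatrixSystem ι A D) (φ : C →⋆ₙₐ[ℂ] A) (hφ : Function.Injective φ) :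
    MatrixSystem ι C D where
  e i j := (M.e i j).comp (φ : C →ₗ[ℂ] A)
  mul_same _ _ _ _ _ := by simp [M.mul_same]
  mul_ne _ _ _ _ _ _ h := by simp [M.mul_ne _ _ _ _ _ _ h]
  star_e _ _ _ := by simp [M.star_e, map_star]
  injective _ _ := (M.injective _ _).comp hφ

theorem IsDense.reindex {M : MatrixSystem ι A D} (hM : M.IsDense) (f : κ ≃ ι) :
    (M.reindex f f.injective).IsDense := by
  have : {x : D | ∃ i j a, x = (M.reindex f f.injective).e i j a} =
      {x : D | ∃ i j a, x = M.e i j a} := by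
    ext x
    constructor
    · rintro ⟨i, j, a, rfl⟩
      exact ⟨_, _, _, rfl⟩
    · rintro ⟨i, j, a, rfl⟩
      exact ⟨f.symm i, f.symm j, a, by simp [MatrixSystem.reindex]⟩
  rw [IsDense, this]
  exact hM

/-- For a finite index set, a matrix system is a *-homomorphism from the C*-algebra of matrices. -/
def toHom [Fintype κ] (M : MatrixSystem κ A D) : CStarMatrix κ κ A →⋆ₙₐ[ℂ] D where
  toFun x := ∑ i, ∑ j, M.e i j (x i j)
  map_smul' c x := by simp [Finset.smul_sum]
  map_zero' := by simp
  map_add' x y := by simp [Finset.sum_add_distrib]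
  map_mul' x y := by
    have h (i j : κ) : M.e i j (x i j) * ∑ k, ∑ l, M.e k l (y k l) =
        ∑ l, M.e i l (x i j * y j l) := by
      rw [Finset.mul_sum, Finset.sum_eq_single j]
      · simp only [Finset.mul_sum, M.mul_same]
      · intro k _ hk
        rw [Finset.mul_sum]
        exact Finset.sum_eq_zero fun l _ => M.mul_ne _ _ _ _ _ _ hk.symm
      · simp
    change ∑ i, ∑ l, M.e i l (∑ j, x i j * y j l) = _
    simp only [Finset.sum_mul, h, map_sum]
    exact Finset.sum_congr rfl fun i _ => Finset.sum_comm
  map_star' x := by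
    simp only [star_sum, M.star_e]
    rw [Finset.sum_comm]
    rfl

theorem toHom_apply [Fintype κ] (M : MatrixSystem κ A D) (x : CStarMatrix κ κ A) :
    M.toHom x = ∑ i, ∑ j, M.e i j (x i j) := rfl

/-- Compressing by `e i i` and `e j j` isolates an entry of a matrix. -/
theorem e_mul_toHom_mul_e [Fintype κ] (M : MatrixSystem κ A D) (x : CStarMatrix κ κ A) (i j : κ)
    (a b : A) : M.e i i a * M.toHom x * M.e j j b = M.e i j (a * x i j * b) := by
  rw [toHom_apply, Finset.mul_sum, Finset.sum_eq_single i, Finset.mul_sum, Finset.sum_mul,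
    Finset.sum_eq_single j, M.mul_same, M.mul_same]
  · intro k _ hk
    rw [M.mul_same, M.mul_ne _ _ _ _ _ _ hk]
  · simp
  · intro k _ hk
    rw [Finset.mul_sum]
    exact Finset.sum_eq_zero fun l _ => M.mul_ne _ _ _ _ _ _ hk.symm
  · simp

theorem _root_.eq_zero_of_star_mul_self_mul_star {a : A} (h : star a * a * star a = 0) : a = 0 := by
  have h1 : star (a * star a) * (a * star a) = 0 := by
    rw [star_mul, star_star, ← mul_assoc, mul_assoc a, mul_assoc a, h, mul_zero]
  rwa [CStarRing.star_mul_self_eq_zero_iff, CStarRing.mul_star_self_eq_zero_iff] at h1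

theorem toHom_injective [Fintype κ] (M : MatrixSystem κ A D) : Function.Injective M.toHom := by
  rw [injective_iff_map_eq_zero]
  intro x hx
  ext i j
  have h := M.e_mul_toHom_mul_e x i j (star (x i j)) (star (x i j))
  rw [hx, mul_zero, zero_mul] at h
  exact eq_zero_of_star_mul_self_mul_star (M.injective i j (h.symm.trans (map_zero _).symm))

/-- The elements of the span are the images of finite matrices. -/
theorem exists_eq_toHom_of_mem_span (M : MatrixSystem ι A D) {x : D}
    (hx : x ∈ Submodule.span ℂ {x : D | ∃ i j a, x = M.e i j a}) :
    ∃ (s : Finset ι) (y : CStarMatrix s s A),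
      x = (M.reindex ((↑) : s → ι) Subtype.val_injective).toHom y := by
  classical
  have key : x ∈ LinearMap.range (Finsupp.lsum (M := A) ℂ fun ij : ι × ι => M.e ij.1 ij.2) := by
    refine Submodule.span_le.2 ?_ hx
    rintro _ ⟨i, j, a, rfl⟩
    exact ⟨Finsupp.single (i, j) a, by simp⟩
  obtain ⟨f, rfl⟩ := key
  refine ⟨f.support.image Prod.fst ∪ f.support.image Prod.snd,
    CStarMatrix.ofMatrix (Matrix.of fun i j => f (i.1, j.1)), ?_⟩
  set s := f.support.image Prod.fst ∪ f.support.image Prod.snd with hs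
  rw [toHom_apply]
  change _ = ∑ i : s, ∑ j : s, M.e i.1 j.1 (f (i.1, j.1))
  rw [Finset.sum_coe_sort s (fun i => ∑ j : s, M.e i j.1 (f (i, j.1)))]
  have : ∀ i, ∑ j : s, M.e i j.1 (f (i, j.1)) = ∑ j ∈ s, M.e i j (f (i, j)) := fun i =>
    Finset.sum_coe_sort s (fun j => M.e i j (f (i, j)))
  simp only [this]
  rw [← Finset.sum_product', Finsupp.lsum_apply]
  refine Finsupp.sum_of_support_subset _ ?_ _ (by simp)
  intro ij hij
  rw [Finset.mem_product]
  exact ⟨Finset.mem_union_left _ (Finset.mem_image_of_mem _ hij),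
    Finset.mem_union_right _ (Finset.mem_image_of_mem _ hij)⟩

/-- A matrix system determines the norm of its finite sums, because an injective *-homomorphism
between C*-algebras is isometric. -/
theorem norm_toHom_eq [Fintype κ] (M : MatrixSystem κ A D) (N : MatrixSystem κ A D')
    (x : CStarMatrix κ κ A) : ‖M.toHom x‖ = ‖N.toHom x‖ := by
  let _ := CStarAlgebra.spectralOrder A
  let _ := CStarAlgebra.spectralOrderedRing A
  exact (NonUnitalStarAlgHom.norm_map M.toHom M.toHom_injective x).trans
    (NonUnitalStarAlgHom.norm_map N.toHom N.toHom_injective x).symm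

theorem norm_e (M : MatrixSystem ι A D) (i j : ι) (a : A) : ‖M.e i j a‖ = ‖a‖ := by
  let φ : A →⋆ₙₐ[ℂ] D :=
    { M.e j j with
      map_zero' := map_zero (M.e j j)
      map_mul' := fun a b => (M.mul_same j j j a b).symm
      map_star' := fun a => (M.star_e j j a).symm }
  have h : ‖φ (star a * a)‖ = ‖star a * a‖ :=
    NonUnitalStarAlgHom.norm_map φ (M.injective j j) _
  have h2 : φ (star a * a) = star (M.e i j a) * M.e i j a := by
    rw [M.star_e, M.mul_same]; rfl
  rw [h2, CStarRing.norm_star_mul_self, CStarRing.norm_star_mul_self] at h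
  exact (mul_self_inj (norm_nonneg _) (norm_nonneg _)).1 h

theorem continuous_e (M : MatrixSystem ι A D) (i j : ι) : Continuous (M.e i j) :=
  (AddMonoidHomClass.isometry_of_norm (M.e i j) (M.norm_e i j)).continuous

/-- The diagonal matrix system in a product. -/
def prod (M : MatrixSystem ι A D) (N : MatrixSystem ι A D') : MatrixSystem ι A (D × D') where
  e i j := (M.e i j).prod (N.e i j)
  mul_same i j l a b := Prod.ext (M.mul_same i j l a b) (N.mul_same i j l a b)
  mul_ne i j j' l a b h := Prod.ext (M.mul_ne i j j' l a b h) (N.mul_ne i j j' l a b h)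
  star_e i j a := Prod.ext (M.star_e i j a) (N.star_e i j a)
  injective i j _ _ h := M.injective i j (Prod.ext_iff.1 h).1

theorem norm_fst_eq_norm_snd (M : MatrixSystem ι A D) (N : MatrixSystem ι A D') {z : D × D'}
    (hz : z ∈ (M.prod N).spanSubalgebra.topologicalClosure) : ‖z.1‖ = ‖z.2‖ := by
  refine closure_minimal (s := ((M.prod N).spanSubalgebra : Set (D × D')))
    (t := {z : D × D' | ‖z.1‖ = ‖z.2‖}) ?_ ?_ hz
  · intro z hz
    obtain ⟨s, y, rfl⟩ := (M.prod N).exists_eq_toHom_of_mem_span hz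
    have := norm_toHom_eq (M.reindex ((↑) : s → ι) Subtype.val_injective)
      (N.reindex ((↑) : s → ι) Subtype.val_injective) y
    rw [toHom_apply, toHom_apply] at this
    simp only [Set.mem_ofPred_eq, toHom_apply, Prod.fst_sum, Prod.snd_sum]
    exact this
  · exact isClosed_eq (by fun_prop) (by fun_prop)

/-- Dense matrix systems are universal: the assignment `M.e i j a ↦ N.e i j a` extends to an
injective *-homomorphism.  Its graph is the closed span of the diagonal system in `D × D'`, on
which both projections are isometric. -/
theorem exists_injective_hom (M : MatrixSystem ι A D) (hM : M.IsDense) (N : MatrixSystem ι A D') :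
    ∃ φ : D →⋆ₙₐ[ℂ] D', Function.Injective φ ∧ ∀ i j a, φ (M.e i j a) = N.e i j a := by
  let G := (M.prod N).spanSubalgebra.topologicalClosure
  have hcl : IsClosed (G : Set (D × D')) :=
    NonUnitalStarSubalgebra.isClosed_topologicalClosure _
  let _ : NonUnitalCStarAlgebra G := NonUnitalStarSubalgebra.nonUnitalCStarAlgebra G
    (h_closed := hcl)
  let p : G →⋆ₙₐ[ℂ] D := (NonUnitalStarAlgHom.fst ℂ D D').comp (NonUnitalStarSubalgebraClass.subtype G)
  let q : G →⋆ₙₐ[ℂ] D' := (NonUnitalStarAlgHom.snd ℂ D D').comp (NonUnitalStarSubalgebraClass.subtype G)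
  have hp_inj : Function.Injective p := by
    rw [injective_iff_map_eq_zero]
    rintro ⟨z, hz⟩ (h : z.1 = 0)
    have h2 := norm_fst_eq_norm_snd M N hz
    rw [h, norm_zero, eq_comm, norm_eq_zero] at h2
    exact Subtype.ext (Prod.ext h h2)
  have hq_inj : Function.Injective q := by
    rw [injective_iff_map_eq_zero]
    rintro ⟨z, hz⟩ (h : z.2 = 0)
    have h2 := norm_fst_eq_norm_snd M N hz
    rw [h, norm_zero, norm_eq_zero] at h2
    exact Subtype.ext (Prod.ext h2 h)
  have hp_iso : Isometry p := NonUnitalStarAlgHom.isometry p hp_inj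
  have hmem : ∀ i j a, (M.e i j a, N.e i j a) ∈ G := fun i j a =>
    NonUnitalStarSubalgebra.le_topologicalClosure _ ((M.prod N).e_mem_spanSubalgebra i j a)
  have hp_surj : Function.Surjective p := by
    have hcr : IsClosed (Set.range p) := hp_iso.isClosedEmbedding.isClosed_range
    have hsub : (Submodule.span ℂ {x : D | ∃ i j a, x = M.e i j a} : Set D) ⊆ Set.range p := by
      have : Submodule.span ℂ {x : D | ∃ i j a, x = M.e i j a} ≤
          LinearMap.range (p : G →ₗ[ℂ] D) := by
        rw [Submodule.span_le]
        rintro _ ⟨i, j, a, rfl⟩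
        exact ⟨⟨_, hmem i j a⟩, rfl⟩
      exact this
    intro x
    have := (hM.mono hsub).closure_eq
    rw [hcr.closure_eq] at this
    exact Set.range_eq_univ.1 this x
  let P : G ≃⋆ₐ[ℂ] D := StarAlgEquiv.ofBijective p ⟨hp_inj, hp_surj⟩
  refine ⟨q.comp (P.symm : D →⋆ₙₐ[ℂ] G), hq_inj.comp P.symm.injective, fun i j a => ?_⟩
  have : P.symm (M.e i j a) = ⟨_, hmem i j a⟩ := by
    rw [StarAlgEquiv.symm_apply_eq]
    rfl
  change q (P.symm (M.e i j a)) = _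
  rw [this]
  rfl

/-- An injective *-homomorphism between C*-algebras with dense range is an isomorphism. -/
theorem _root_.NonUnitalStarAlgHom.surjective_of_dense {φ : D →⋆ₙₐ[ℂ] D'}
    (hφ : Function.Injective φ) {s : Set D'} (hs : Dense (Submodule.span ℂ s : Set D'))
    (h : ∀ x ∈ s, ∃ y, φ y = x) : Function.Surjective φ := by
  have hcr : IsClosed (Set.range φ) :=
    (NonUnitalStarAlgHom.isometry φ hφ).isClosedEmbedding.isClosed_range
  have hsub : (Submodule.span ℂ s : Set D') ⊆ Set.range φ := by
    have : Submodule.span ℂ s ≤ LinearMap.range (φ : D →ₗ[ℂ] D') := Submodule.span_le.2 h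
    exact this
  intro x
  have := (hs.mono hsub).closure_eq
  rw [hcr.closure_eq] at this
  exact Set.range_eq_univ.1 this x

theorem nonempty_starAlgEquiv (M : MatrixSystem ι A D) (hM : M.IsDense) (N : MatrixSystem ι A D')
    (hN : N.IsDense) : Nonempty (D ≃⋆ₐ[ℂ] D') := by
  obtain ⟨φ, hφ, h⟩ := M.exists_injective_hom hM N
  refine ⟨StarAlgEquiv.ofBijective φ ⟨hφ, NonUnitalStarAlgHom.surjective_of_dense hφ hN ?_⟩⟩
  rintro _ ⟨i, j, a, rfl⟩
  exact ⟨_, h i j a⟩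

/-- Matrices over matrices: a system over `A` and a system over `C` inside `A` give a system over
`C` indexed by pairs. -/
def comp (M : MatrixSystem κ A D) (N : MatrixSystem ι C A) : MatrixSystem (κ × ι) C D where
  e i j := (M.e i.1 j.1).comp (N.e i.2 j.2)
  mul_same i j l a b := by simp [M.mul_same, N.mul_same]
  mul_ne i j j' l a b h := by
    by_cases h1 : j.1 = j'.1
    · have h2 : j.2 ≠ j'.2 := fun h2 => h (Prod.ext h1 h2)
      simp [h1, M.mul_same, N.mul_ne _ _ _ _ _ _ h2]
    · simp [M.mul_ne _ _ _ _ _ _ h1]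
  star_e i j a := by simp [M.star_e, N.star_e]
  injective i j := (M.injective _ _).comp (N.injective _ _)

theorem IsDense.comp {M : MatrixSystem κ A D} {N : MatrixSystem ι C A} (hM : M.IsDense)
    (hN : N.IsDense) : (M.comp N).IsDense := by
  refine Dense.of_closure (hM.mono ?_)
  set S := Submodule.span ℂ {x : D | ∃ i j a, x = (M.comp N).e i j a}
  have : Submodule.span ℂ {x : D | ∃ i j a, x = M.e i j a} ≤ S.topologicalClosure := by
    rw [Submodule.span_le]
    rintro _ ⟨i, j, a, rfl⟩
    have ha : a ∈ closure (Submodule.span ℂ {x : A | ∃ i j c, x = N.e i j c} : Set A) :=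
      hN a
    refine map_mem_closure (M.continuous_e i j) ha ?_
    have : Submodule.span ℂ {x : A | ∃ i j c, x = N.e i j c} ≤ S.comap (M.e i j) := by
      rw [Submodule.span_le]
      rintro _ ⟨k, l, c, rfl⟩
      exact Submodule.subset_span ⟨(i, k), (j, l), c, rfl⟩
    exact this
  exact this

end MatrixSystem

/-! ### Existence of matrix systems -/

namespace MatrixSystem

variable {ι : Type*} {A D : Type*} [NonUnitalCStarAlgebra A] [NonUnitalCStarAlgebra D]

/-- A matrix system lies densely in the closed span of its elements. -/
def toClosure (M : MatrixSystem ι A D) :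
    letI := NonUnitalStarSubalgebra.nonUnitalCStarAlgebra M.spanSubalgebra.topologicalClosure
      (h_closed := NonUnitalStarSubalgebra.isClosed_topologicalClosure _)
    MatrixSystem ι A M.spanSubalgebra.topologicalClosure :=
  letI := NonUnitalStarSubalgebra.nonUnitalCStarAlgebra M.spanSubalgebra.topologicalClosure
    (h_closed := NonUnitalStarSubalgebra.isClosed_topologicalClosure _)
  { e := fun i j =>
      { toFun := fun a => ⟨M.e i j a, NonUnitalStarSubalgebra.le_topologicalClosure _
          (M.e_mem_spanSubalgebra i j a)⟩
        map_add' := fun _ _ => Subtype.ext (map_add _ _ _)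
        map_smul' := fun _ _ => Subtype.ext (map_smul _ _ _) }
    mul_same := fun i j l a b => Subtype.ext (M.mul_same i j l a b)
    mul_ne := fun i j j' l a b h => Subtype.ext (M.mul_ne i j j' l a b h)
    star_e := fun i j a => Subtype.ext (M.star_e i j a)
    injective := fun i j _ _ h => M.injective i j (Subtype.ext_iff.1 h) }

theorem toClosure_isDense (M : MatrixSystem ι A D) :
    letI := NonUnitalStarSubalgebra.nonUnitalCStarAlgebra M.spanSubalgebra.topologicalClosure
      (h_closed := NonUnitalStarSubalgebra.isClosed_topologicalClosure _)
    M.toClosure.IsDense := by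
  let _ := NonUnitalStarSubalgebra.nonUnitalCStarAlgebra M.spanSubalgebra.topologicalClosure
    (h_closed := NonUnitalStarSubalgebra.isClosed_topologicalClosure _)
  intro z
  have hz : (z : D) ∈ closure (M.spanSubalgebra : Set D) := z.2
  rw [closure_subtype]
  refine closure_mono ?_ hz
  have h : Submodule.span ℂ {x : D | ∃ i j a, x = M.e i j a} ≤
      (Submodule.span ℂ {x | ∃ i j a, x = M.toClosure.e i j a}).map
        (NonUnitalStarSubalgebraClass.subtype M.spanSubalgebra.topologicalClosure :
          M.spanSubalgebra.topologicalClosure →ₗ[ℂ] D) := by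
    rw [Submodule.span_le]
    rintro _ ⟨i, j, a, rfl⟩
    exact ⟨_, Submodule.subset_span ⟨i, j, a, rfl⟩, rfl⟩
  exact h

end MatrixSystem

section Hilbert

variable {H : Type*} [NormedAddCommGroup H] [InnerProductSpace ℂ H] [CompleteSpace H]

/-- The inclusion of the `i`-th summand in `ℓ²(ι; H)`. -/
noncomputable def hilbertInclusion {ι : Type*} [DecidableEq ι] (i : ι) :
    H →L[ℂ] lp (fun _ : ι => H) 2 :=
  lp.singleContinuousLinearMap ℂ (fun _ : ι => H) 2 i

open ContinuousLinearMap in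
theorem adjoint_hilbertInclusion_comp {ι : Type*} [DecidableEq ι] (i j : ι) :
    adjoint (hilbertInclusion (H := H) i) ∘L hilbertInclusion j =
      if i = j then ContinuousLinearMap.id ℂ H else 0 := by
  ext x
  refine ext_inner_left ℂ fun y => ?_
  rw [ContinuousLinearMap.comp_apply, adjoint_inner_right]
  simp only [hilbertInclusion, lp.singleContinuousLinearMap_apply]
  rw [lp.inner_single_left, lp.single_apply]
  split_ifs with h
  · subst h; simp
  · simp [Pi.single_eq_of_ne h]

open ContinuousLinearMap in
/-- The elementary matrices over an algebra of operators on `H`, as operators on `ℓ²(ι; H)`. -/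
noncomputable def operatorMatrixSystem (ι : Type*) [DecidableEq ι] {A : Type*}
    [NonUnitalCStarAlgebra A] (ρ : A →⋆ₙₐ[ℂ] (H →L[ℂ] H)) (hρ : Function.Injective ρ) :
    MatrixSystem ι A (lp (fun _ : ι => H) 2 →L[ℂ] lp (fun _ : ι => H) 2) where
  e i j :=
    { toFun := fun a => hilbertInclusion i ∘L ρ a ∘L adjoint (hilbertInclusion j)
      map_add' := fun a b => by simp
      map_smul' := fun c a => by simp }
  mul_same i j l a b := by
    have h := adjoint_hilbertInclusion_comp (H := H) j j
    rw [if_pos rfl] at h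
    ext1 x
    have h' := fun y => DFunLike.congr_fun h y
    simp only [ContinuousLinearMap.comp_apply, ContinuousLinearMap.id_apply] at h'
    simp [h']
  mul_ne i j j' l a b hj := by
    have h := adjoint_hilbertInclusion_comp (H := H) j j'
    rw [if_neg hj] at h
    ext1 x
    have h' := fun y => DFunLike.congr_fun h y
    simp only [ContinuousLinearMap.comp_apply, zero_apply] at h'
    simp [h']
  star_e i j a := by
    simp only [LinearMap.coe_mk, AddHom.coe_mk, star_eq_adjoint, adjoint_comp,
      adjoint_adjoint, map_star, ContinuousLinearMap.comp_assoc]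
  injective i j a b hab := by
    apply hρ
    have h (k : ι) (y : H) : adjoint (hilbertInclusion k) (hilbertInclusion k y) = y := by
      have := DFunLike.congr_fun (adjoint_hilbertInclusion_comp (H := H) k k) y
      simpa using this
    ext1 x
    have := congrArg (fun T => adjoint (hilbertInclusion i) (T (hilbertInclusion j x))) hab
    simpa [h] using this

end Hilbert

section Multiplication

variable {X : Type*} [TopologicalSpace X] [CompactSpace X]

theorem memℓp_mul (f : C(X, ℂ)) (ξ : lp (fun _ : X => ℂ) 2) :
    Memℓp (fun x => f x * ξ x) 2 := by
  have h := (lp.memℓp ξ).const_smul (‖f‖ : ℂ)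
  refine memℓp_gen ?_
  have h2 := h.summable (by norm_num)
  refine Summable.of_nonneg_of_le (fun _ => by positivity) (fun x => ?_) h2
  gcongr
  simp only [Pi.smul_apply, norm_smul, norm_mul, Complex.norm_real, norm_norm]
  gcongr
  exact f.norm_coe_le_norm x

theorem lp_norm_mul_le (f : C(X, ℂ)) (ξ : lp (fun _ : X => ℂ) 2) :
    ‖(⟨_, memℓp_mul f ξ⟩ : lp (fun _ : X => ℂ) 2)‖ ≤ ‖f‖ * ‖ξ‖ := by
  have h : ‖f‖ * ‖ξ‖ = ‖(‖f‖ : ℂ) • ξ‖ := by rw [norm_smul]; simp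
  rw [h]
  refine lp.norm_mono (by norm_num) fun x => ?_
  simp only [lp.coeFn_smul, Pi.smul_apply, norm_smul, norm_mul, Complex.norm_real, norm_norm]
  gcongr
  exact f.norm_coe_le_norm x

/-- Continuous functions act by multiplication on `ℓ²(X)`. -/
noncomputable def multiplicationRep :
    C(X, ℂ) →⋆ₙₐ[ℂ] (lp (fun _ : X => ℂ) 2 →L[ℂ] lp (fun _ : X => ℂ) 2) where
  toFun f := LinearMap.mkContinuous
    { toFun := fun ξ => ⟨_, memℓp_mul f ξ⟩
      map_add' := fun ξ η => by ext x; exact mul_add _ _ _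
      map_smul' := fun c ξ => by ext x; exact mul_left_comm _ _ _ } ‖f‖ (lp_norm_mul_le f)
  map_smul' c f := by ext ξ x; exact mul_assoc _ _ _
  map_zero' := by ext ξ x; exact zero_mul _
  map_add' f g := by ext ξ x; exact add_mul _ _ _
  map_mul' f g := by ext ξ x; exact mul_assoc _ _ _
  map_star' f := by
    rw [ContinuousLinearMap.star_eq_adjoint, ContinuousLinearMap.eq_adjoint_iff]
    intro ξ η
    rw [lp.inner_eq_tsum, lp.inner_eq_tsum]
    refine tsum_congr fun x => ?_
    simp only [LinearMap.mkContinuous_apply, LinearMap.coe_mk, AddHom.coe_mk, RCLike.inner_apply,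
      ContinuousMap.star_apply, map_mul, RCLike.star_def, Complex.conj_conj]
    ring

theorem multiplicationRep_injective : Function.Injective (multiplicationRep (X := X)) := by
  classical
  intro f g h
  ext x
  have := congrArg (fun T => (T (lp.single 2 x (1 : ℂ)) : lp (fun _ : X => ℂ) 2) x) h
  have h1 (f : C(X, ℂ)) : (multiplicationRep f (lp.single 2 x (1 : ℂ)) : lp (fun _ : X => ℂ) 2) x =
      f x * (lp.single 2 x (1 : ℂ) : lp (fun _ : X => ℂ) 2) x := rfl
  simpa [h1] using this

end Multiplication

/-! ### Matrices over the Cantor space form an AF algebra -/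

section Cantor

open Filter Topology

/-- Functions of the first `n` coordinates, as functions on the Cantor space. -/
noncomputable def cantorPullback (n : ℕ) : C(Fin n → Bool, ℂ) →⋆ₙₐ[ℂ] C(ℕ → Bool, ℂ) :=
  (ContinuousMap.compStarAlgHom' ℂ ℂ
    (⟨fun x i => x i, by fun_prop⟩ : C(ℕ → Bool, Fin n → Bool)) : C(Fin n → Bool, ℂ) →⋆ₙₐ[ℂ] _)

theorem cantorPullback_apply (n : ℕ) (g : C(Fin n → Bool, ℂ)) (x : ℕ → Bool) :
    cantorPullback n g x = g fun i => x i := rfl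

theorem cantorPullback_injective (n : ℕ) : Function.Injective (cantorPullback n) := by
  intro f g h
  ext x
  have := DFunLike.congr_fun h fun i => if hi : i < n then x ⟨i, hi⟩ else false
  simpa [cantorPullback_apply] using this

theorem exists_cantorPullback_eq {m n : ℕ} (h : m ≤ n) (g : C(Fin m → Bool, ℂ)) :
    ∃ g', cantorPullback n g' = cantorPullback m g :=
  ⟨g.comp ⟨fun x i => x (Fin.castLE h i), by fun_prop⟩, rfl⟩

/-- Replacing the coordinates from the `n`-th on by `false` converges uniformly to the identity, so
functions of finitely many coordinates are dense. -/
theorem mem_closure_cantorPullback (f : C(ℕ → Bool, ℂ)) :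
    f ∈ closure (⋃ n, Set.range (cantorPullback n)) := by
  let ext (n : ℕ) : C(Fin n → Bool, ℕ → Bool) :=
    ⟨fun x i => if hi : i < n then x ⟨i, hi⟩ else false, continuous_of_discreteTopology⟩
  refine mem_closure_of_tendsto (f := fun n => cantorPullback n (f.comp (ext n))) (b := atTop) ?_
    (Eventually.of_forall fun n => Set.mem_iUnion.2 ⟨n, _, rfl⟩)
  rw [ContinuousMap.tendsto_iff_tendstoUniformly]
  have hf : UniformContinuous f := CompactSpace.uniformContinuous_of_continuous f.continuous
  refine UniformContinuous.comp_tendstoUniformly (g := f)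
    (F := fun n (x : ℕ → Bool) => ext n fun i => x i) (f := fun x => x) hf ?_
  rw [tendstoUniformly_iff_tendsto, Pi.uniformity, tendsto_iInf]
  intro i
  rw [tendsto_comap_iff]
  have h1 : ∀ᶠ z : ℕ × (ℕ → Bool) in atTop ×ˢ ⊤, i < z.1 :=
    (eventually_gt_atTop i).prod_inl _
  refine Tendsto.congr' (f₁ := fun z : ℕ × (ℕ → Bool) => (z.2 i, z.2 i)) ?_ ?_
  · filter_upwards [h1] with z hz
    simp [ext, hz]
  · exact tendsto_diag_uniformity _ _

end Cantor

namespace MatrixSystem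

variable {D : Type*} [NonUnitalCStarAlgebra D]

/-- The matrices over functions of the first `n` coordinates with entries in the upper left `n × n`
block. -/
noncomputable def cantorStage (M : MatrixSystem ℕ C(ℕ → Bool, ℂ) D) (n : ℕ) :
    MatrixSystem (Fin n) C(Fin n → Bool, ℂ) D :=
  (M.reindex Fin.val Fin.val_injective).comapCoeff (cantorPullback n) (cantorPullback_injective n)

theorem spanSubalgebra_cantorStage_mono (M : MatrixSystem ℕ C(ℕ → Bool, ℂ) D) :
    Monotone fun n => (M.cantorStage n).spanSubalgebra := by
  intro m n h
  have : Submodule.span ℂ {x : D | ∃ i j a, x = (M.cantorStage m).e i j a} ≤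
      Submodule.span ℂ {x : D | ∃ i j a, x = (M.cantorStage n).e i j a} := by
    rw [Submodule.span_le]
    rintro _ ⟨i, j, g, rfl⟩
    obtain ⟨g', hg'⟩ := exists_cantorPullback_eq h g
    refine Submodule.subset_span ⟨Fin.castLE h i, Fin.castLE h j, g', ?_⟩
    change M.e i j (cantorPullback m g) = M.e i j (cantorPullback n g')
    rw [hg']
  exact this

theorem isAF_of_cantor (M : MatrixSystem ℕ C(ℕ → Bool, ℂ) D) (hM : M.IsDense) : IsAF D := by
  refine ⟨fun n => (M.cantorStage n).spanSubalgebra, M.spanSubalgebra_cantorStage_mono,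
    fun n => ?_, ?_⟩
  · have : FiniteDimensional ℂ C(Fin n → Bool, ℂ) :=
      FiniteDimensional.of_injective
        (⟨⟨fun f x => f x, fun _ _ => rfl⟩, fun _ _ => rfl⟩ :
          C(Fin n → Bool, ℂ) →ₗ[ℂ] (Fin n → Bool) → ℂ) DFunLike.coe_injective
    have hle : (M.cantorStage n).spanSubalgebra.toSubmodule ≤
        ⨆ ij : Fin n × Fin n, LinearMap.range ((M.cantorStage n).e ij.1 ij.2) := by
      refine Submodule.span_le.2 ?_
      rintro _ ⟨i, j, g, rfl⟩
      exact Submodule.mem_iSup_of_mem (i, j) ⟨g, rfl⟩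
    exact Submodule.finiteDimensional_of_le hle
  · refine Dense.of_closure (hM.mono ?_)
    let S : Submodule ℂ D := ⨆ n, (M.cantorStage n).spanSubalgebra.toSubmodule
    have hS : (S : Set D) = ⋃ n, ((M.cantorStage n).spanSubalgebra : Set D) := by
      refine Submodule.coe_iSup_of_directed _ (Monotone.directed_le fun m n h => ?_)
      exact M.spanSubalgebra_cantorStage_mono h
    rw [← hS]
    have : Submodule.span ℂ {x : D | ∃ i j a, x = M.e i j a} ≤ S.topologicalClosure := by
      rw [Submodule.span_le]
      rintro _ ⟨i, j, a, rfl⟩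
      refine map_mem_closure (M.continuous_e i j) (mem_closure_cantorPullback a) ?_
      rintro _ hf
      obtain ⟨n, g, rfl⟩ := Set.mem_iUnion.1 hf
      have hn : n ≤ max n (max (i + 1) (j + 1)) := le_max_left _ _
      obtain ⟨g', hg'⟩ := exists_cantorPullback_eq hn g
      refine Submodule.mem_iSup_of_mem (max n (max (i + 1) (j + 1))) ?_
      rw [← hg']
      exact (M.cantorStage _).e_mem_spanSubalgebra ⟨i, by lia⟩ ⟨j, by lia⟩ g'
    exact this

end MatrixSystem

/-- A C*-algebra that is densely spanned by matrices of countable size over `C(X)`, `X` compact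
metrisable, is AF-embeddable: `X` is a continuous image of the Cantor space `K`, so the algebra
embeds into `C(K) ⊗ 𝒦`. -/
theorem MatrixSystem.afEmbeddable {ι : Type*} [Countable ι] {X : Type*} [Nonempty X] [MetricSpace X]
    [CompactSpace X] {A : Type*} [NonUnitalCStarAlgebra A] (M : MatrixSystem ι C(X, ℂ) A)
    (hM : M.IsDense) : AFEmbeddable A := by
  obtain ⟨π, hπ, hπs⟩ := exists_nat_bool_continuous_surjective_of_compact X
  let φ : C(X, ℂ) →⋆ₙₐ[ℂ] C(ℕ → Bool, ℂ) :=
    (ContinuousMap.compStarAlgHom' ℂ ℂ ⟨π, hπ⟩ : C(X, ℂ) →⋆ₙₐ[ℂ] _)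
  have hφ : Function.Injective φ := by
    intro f g h
    ext x
    obtain ⟨y, rfl⟩ := hπs x
    exact DFunLike.congr_fun h y
  obtain ⟨ν, hν⟩ := exists_injective_nat ι
  let N := operatorMatrixSystem ℕ (multiplicationRep (X := ℕ → Bool)) multiplicationRep_injective
  let _ := NonUnitalStarSubalgebra.nonUnitalCStarAlgebra N.spanSubalgebra.topologicalClosure
    (h_closed := NonUnitalStarSubalgebra.isClosed_topologicalClosure _)
  obtain ⟨ψ, hψ, -⟩ := M.exists_injective_hom hM ((N.toClosure.reindex ν hν).comapCoeff φ hφ)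
  exact ⟨N.spanSubalgebra.topologicalClosure, inferInstance,
    N.toClosure.isAF_of_cantor N.toClosure_isDense, ψ, hψ⟩

/-- A C*-algebra that is densely spanned by matrices of nonzero countable size over `C(X)`, `X`
compact, is stably isomorphic to `C(X)`. -/
theorem MatrixSystem.stablyIsomorphic {ι : Type*} [Countable ι] [Nonempty ι] {X : Type}
    [TopologicalSpace X] [CompactSpace X] {A : Type u} [NonUnitalCStarAlgebra A]
    (M : MatrixSystem ι C(X, ℂ) A) (hM : M.IsDense) : StablyIsomorphic A C(X, ℂ) := by
  classical
  -- `A` acts faithfully on the Hilbert space of the elementary matrices over `C(X)`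
  obtain ⟨ν, hν⟩ := exists_injective_nat ι
  obtain ⟨ρ, hρ, -⟩ := M.exists_injective_hom hM
    ((operatorMatrixSystem ℕ (multiplicationRep (X := X)) multiplicationRep_injective).reindex ν hν)
  let N := operatorMatrixSystem (ULift.{u} ℕ) ρ hρ
  let _ := NonUnitalStarSubalgebra.nonUnitalCStarAlgebra N.spanSubalgebra.topologicalClosure
    (h_closed := NonUnitalStarSubalgebra.isClosed_topologicalClosure _)
  let N' := operatorMatrixSystem ℕ (multiplicationRep (X := X)) multiplicationRep_injective
  let _ := NonUnitalStarSubalgebra.nonUnitalCStarAlgebra N'.spanSubalgebra.topologicalClosure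
    (h_closed := NonUnitalStarSubalgebra.isClosed_topologicalClosure _)
  let S := N.toClosure.reindex Equiv.ulift.symm Equiv.ulift.symm.injective
  have hS : S.IsDense := N.toClosure_isDense.reindex Equiv.ulift.symm
  have : Infinite (ℕ × ι) := inferInstance
  obtain ⟨eq⟩ : Nonempty (ℕ ≃ ℕ × ι) := nonempty_equiv_of_countable
  refine ⟨N.spanSubalgebra.topologicalClosure, inferInstance,
    N'.spanSubalgebra.topologicalClosure, inferInstance,
    ⟨⟨S.e, S.mul_same, S.mul_ne, S.star_e, S.injective, hS⟩⟩,
    ⟨⟨N'.toClosure.e, N'.toClosure.mul_same, N'.toClosure.mul_ne, N'.toClosure.star_e,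
      N'.toClosure.injective, N'.toClosure_isDense⟩⟩, ?_⟩
  exact MatrixSystem.nonempty_starAlgEquiv ((S.comp M).reindex eq eq.injective)
    ((hS.comp hM).reindex eq) N'.toClosure N'.toClosure_isDense

/-! ### Factorisation in higher-rank graphs -/

namespace KGraph

variable {k : ℕ} {V : Type u} [Category.{v} V] (Λ : KGraph k V)

theorem d_id (v : V) : Λ.d (𝟙 v) = 0 := by
  have h := Λ.d_comp (𝟙 v) (𝟙 v)
  rw [Category.comp_id] at h
  simpa using h

theorem exists_factor {w v : V} (f : w ⟶ v) (m n : Fin k → ℕ) (h : Λ.d f = m + n) :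
    ∃ (u : V) (μ : u ⟶ v) (ν : w ⟶ u), Λ.d μ = m ∧ Λ.d ν = n ∧ ν ≫ μ = f := by
  obtain ⟨⟨u, μ, ν⟩, h, -⟩ := Λ.factorisation f m n h
  exact ⟨u, μ, ν, h⟩

theorem factor_unique {w v u u' : V} {μ : u ⟶ v} {ν : w ⟶ u} {μ' : u' ⟶ v} {ν' : w ⟶ u'}
    (h : ν ≫ μ = ν' ≫ μ') (hd : Λ.d μ = Λ.d μ') :
    (⟨u, μ, ν⟩ : Σ u : V, (u ⟶ v) × (w ⟶ u)) = ⟨u', μ', ν'⟩ := by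
  have hd' : Λ.d ν = Λ.d ν' := by
    have h1 := congrArg Λ.d h
    rw [Λ.d_comp, Λ.d_comp, hd] at h1
    exact add_left_cancel h1
  exact (Λ.factorisation (ν ≫ μ) (Λ.d μ) (Λ.d ν) (Λ.d_comp _ _)).unique ⟨rfl, rfl, rfl⟩
    ⟨hd.symm, hd'.symm, h.symm⟩

theorem prefix_unique {w v u u' : V} {μ : u ⟶ v} {ν : w ⟶ u} {μ' : u' ⟶ v} {ν' : w ⟶ u'}
    (h : ν ≫ μ = ν' ≫ μ') (hd : Λ.d μ = Λ.d μ') :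
    (⟨u, μ⟩ : Σ u : V, (u ⟶ v)) = ⟨u', μ'⟩ := by
  cases Λ.factor_unique h hd
  rfl

theorem comp_right_cancel {k : ℕ} (Λ : KGraph k V) {w v u : V} {μ : u ⟶ v} {ν ν' : w ⟶ u} (h : ν ≫ μ = ν' ≫ μ) :
    ν = ν' := by
  have := Λ.factor_unique h rfl
  simpa using this

theorem eq_id_of_d_eq_zero {w v : V} (f : w ⟶ v) (h : Λ.d f = 0) :
    (⟨w, f⟩ : Σ w : V, (w ⟶ v)) = ⟨v, 𝟙 v⟩ :=
  Λ.prefix_unique (ν := 𝟙 w) (ν' := f) (by simp) (by rw [h, Λ.d_id])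

/-- If `vΛⁿ` has at most one element, two paths of degree `n` into `v` agree, sources included. -/
theorem PathsFrom.eq {Λ : KGraph k V} {v w w' : V} {n : Fin k → ℕ} [Subsingleton (Λ.PathsFrom v n)]
    {f : w ⟶ v} {g : w' ⟶ v} (hf : Λ.d f = n) (hg : Λ.d g = n) :
    (⟨w, f⟩ : Σ w : V, (w ⟶ v)) = ⟨w', g⟩ :=
  Subtype.ext_iff.1 (@Subsingleton.elim (Λ.PathsFrom v n) _ ⟨⟨w, f⟩, hf⟩ ⟨⟨w', g⟩, hg⟩)

theorem subsingleton_pathsFrom {v : V} {n : Fin k → ℕ}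
    (h : ∀ (w w' : V) (f : w ⟶ v) (g : w' ⟶ v), Λ.d f = n → Λ.d g = n →
      (⟨w, f⟩ : Σ w : V, (w ⟶ v)) = ⟨w', g⟩) : Subsingleton (Λ.PathsFrom v n) :=
  ⟨fun ⟨⟨w, f⟩, hf⟩ ⟨⟨w', g⟩, hg⟩ => Subtype.ext (h w w' f g hf hg)⟩

variable {Λ} in
theorem NoSources.exists_path (h : Λ.NoSources) (v : V) (n : Fin k → ℕ) :
    ∃ (w : V) (f : w ⟶ v), Λ.d f = n := by
  obtain ⟨⟨⟨w, f⟩, hf⟩⟩ := h v n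
  exact ⟨w, f, hf⟩

theorem d_closedPathPow {v : V} (f : v ⟶ v) (l : ℕ) : Λ.d (closedPathPow f l) = l • Λ.d f := by
  induction l with
  | zero => rw [closedPathPow, Λ.d_id, zero_smul]
  | succ l ih => rw [closedPathPow, Λ.d_comp, ih, succ_nsmul, add_comm]

/-! ### Vertices that receive a single path of a given degree -/

section Permutation

variable {Λ} {a : V} {n : Fin k → ℕ}

/-- If `aΛⁿ` consists of one closed path `μ`, then a path `f ∈ aΛᵐ` followed by a path `g ∈ s(f)Λⁿ`
has the form `μh` with `h ∈ aΛᵐ`. -/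
theorem exists_comp_eq_comp_closed [Subsingleton (Λ.PathsFrom a n)] (μ : a ⟶ a) (hμ : Λ.d μ = n)
    {w u : V} (f : w ⟶ a) (g : u ⟶ w) (hg : Λ.d g = n) :
    ∃ h : u ⟶ a, Λ.d h = Λ.d f ∧ h ≫ μ = g ≫ f := by
  obtain ⟨b, μ', h, h1, h2, h3⟩ := Λ.exists_factor (g ≫ f) n (Λ.d f)
    (by rw [Λ.d_comp, hg, add_comm])
  cases PathsFrom.eq (Λ := Λ) h1 hμ
  exact ⟨h, h2, h3⟩

/-- If `aΛⁿ` consists of one closed path `μ`, the equation `f g = μ f'` with `g ∈ s(f)Λⁿ` defines a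
permutation `f ↦ f'` of the finite set `aΛᵐ`.  Hence `g` is determined by `f`, and iterating leads
back to `f`: the vertex `s(f)` lies on a closed path whose degree is a multiple of `n`. -/
theorem subsingleton_and_exists_closed (hrow : Λ.RowFinite) (hsrc : Λ.NoSources)
    [Subsingleton (Λ.PathsFrom a n)] (μ : a ⟶ a) (hμ : Λ.d μ = n) {w : V} (f : w ⟶ a) :
    Subsingleton (Λ.PathsFrom w n) ∧ ∃ (l : ℕ) (g : w ⟶ w), 0 < l ∧ Λ.d g = l • n := by
  set m := Λ.d f with hm
  have := hrow a m
  choose c hc using fun p : Λ.PathsFrom a m => hsrc.exists_path p.1.1 n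
  choose g hg using hc
  choose φ hφ1 hφ2 using fun p : Λ.PathsFrom a m => exists_comp_eq_comp_closed μ hμ p.1.2 (g p) (hg p)
  let Φ : Λ.PathsFrom a m → Λ.PathsFrom a m := fun p => ⟨⟨c p, φ p⟩, (hφ1 p).trans p.2⟩
  have key : ∀ (p : Λ.PathsFrom a m) (u : V) (h : u ⟶ a) (_ : Λ.d h = m) (w' : V) (f' : w' ⟶ a)
      (g' : u ⟶ w') (_ : Λ.d f' = m), (Φ p).1 = ⟨u, h⟩ → h ≫ μ = g' ≫ f' →
        (⟨p.1.1, p.1.2, c p, g p⟩ : Σ w : V, (w ⟶ a) × Σ u : V, (u ⟶ w)) = ⟨w', f', u, g'⟩ := by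
    rintro ⟨⟨w₀, f₀⟩, hf₀⟩ u h hh w' f' g' hf' he h2
    have h3 := hφ2 ⟨⟨w₀, f₀⟩, hf₀⟩
    change (⟨c ⟨⟨w₀, f₀⟩, hf₀⟩, φ ⟨⟨w₀, f₀⟩, hf₀⟩⟩ : Σ u : V, (u ⟶ a)) = ⟨u, h⟩ at he
    generalize g ⟨⟨w₀, f₀⟩, hf₀⟩ = g₀ at *
    generalize φ ⟨⟨w₀, f₀⟩, hf₀⟩ = φ₀ at *
    generalize c ⟨⟨w₀, f₀⟩, hf₀⟩ = c₀ at *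
    cases he
    rw [h2] at h3
    cases Λ.factor_unique h3 (hf'.trans hf₀.symm)
    rfl
  have hinj : Function.Injective Φ := by
    intro p q hpq
    have h := key p (c q) (φ q) ((hφ1 q).trans q.2) q.1.1 q.1.2 (g q) q.2
      (congrArg Subtype.val hpq) (hφ2 q)
    have h' := congrArg (fun z : Σ w : V, (w ⟶ a) × Σ u : V, (u ⟶ w) =>
      (⟨z.1, z.2.1⟩ : Σ w : V, (w ⟶ a))) h
    exact Subtype.ext h'
  have hsurj : Function.Surjective Φ := Finite.surjective_of_injective hinj
  constructor
  · have h1 : ∀ (u : V) (g' : u ⟶ w), Λ.d g' = n →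
        (⟨c ⟨⟨w, f⟩, rfl⟩, g ⟨⟨w, f⟩, rfl⟩⟩ : Σ u : V, (u ⟶ w)) = ⟨u, g'⟩ := by
      intro u g' hg'
      obtain ⟨h, hh1, hh2⟩ := exists_comp_eq_comp_closed μ hμ f g' hg'
      obtain ⟨p, hp⟩ := hsurj ⟨⟨u, h⟩, hh1⟩
      have hk := key p u h hh1 w f g' rfl (congrArg Subtype.val hp) hh2
      obtain ⟨⟨w₀, f₀⟩, hf₀⟩ := p
      have hp2 : (⟨⟨w₀, f₀⟩, hf₀⟩ : Λ.PathsFrom a m) = ⟨⟨w, f⟩, rfl⟩ := by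
        have h' := congrArg (fun z : Σ w : V, (w ⟶ a) × Σ u : V, (u ⟶ w) =>
          (⟨z.1, z.2.1⟩ : Σ w : V, (w ⟶ a))) hk
        exact Subtype.ext h'
      cases hp2
      simpa using hk
    exact Λ.subsingleton_pathsFrom fun u u' g₁ g₂ h₁ h₂ => (h1 u g₁ h₁).symm.trans (h1 u' g₂ h₂)
  · have hiter : ∀ (l : ℕ) (p : Λ.PathsFrom a m),
        ∃ h : (Φ^[l] p).1.1 ⟶ p.1.1, Λ.d h = l • n := by
      intro l p
      induction l with
      | zero => exact ⟨𝟙 _, (Λ.d_id _).trans (zero_smul ℕ n).symm⟩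
      | succ l ih =>
        obtain ⟨h, hh⟩ := ih
        rw [Function.iterate_succ_apply']
        exact ⟨g (Φ^[l] p) ≫ h, by rw [Λ.d_comp, hh, hg, succ_nsmul]⟩
    obtain ⟨l, hl, hper⟩ := hinj.mem_periodicPts (⟨⟨w, f⟩, rfl⟩ : Λ.PathsFrom a m)
    have h := hiter l ⟨⟨w, f⟩, rfl⟩
    rw [show Φ^[l] ⟨⟨w, f⟩, rfl⟩ = ⟨⟨w, f⟩, rfl⟩ from hper] at h
    obtain ⟨h, hh⟩ := h
    exact ⟨l, h, hl, hh⟩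

end Permutation

end KGraph

namespace KGraph

variable {k : ℕ} {V : Type u} [Category.{v} V] {Λ : KGraph k V}

/-! ### Cycles without entrance -/

theorem nsmul_basisDegree_injective (i : Fin k) :
    Function.Injective fun n : ℕ => n • (basisDegree i : Fin k → ℕ) := by
  intro m n h
  have := congrFun h i
  simpa [basisDegree] using this

/-- Each path of degree `j eᵢ` into the base of a cycle without entrance is an initial segment of
that cycle. -/
theorem exists_comp_eq_of_hasNoEntrance {i : Fin k} {a : V} {μ : a ⟶ a} {n : ℕ}
    (hμ : Λ.d μ = n • basisDegree i) (hne : Λ.HasNoEntrance i μ) (j : ℕ) (hj : j ≤ n) {b : V}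
    (g : b ⟶ a) (hg : Λ.d g = j • basisDegree i) :
    ∃ ν : a ⟶ b, Λ.d ν = (n - j) • basisDegree i ∧ ν ≫ g = μ := by
  induction j generalizing b with
  | zero =>
    rw [zero_smul] at hg
    cases Λ.eq_id_of_d_eq_zero g hg
    exact ⟨μ, by simpa using hμ, Category.comp_id _⟩
  | succ j ih =>
    obtain ⟨c, g', e, hg', he, rfl⟩ := Λ.exists_factor g (j • basisDegree i) (basisDegree i)
      (by rw [hg, succ_nsmul])
    obtain ⟨ν, hν, rfl⟩ := ih (by lia) g' hg'
    obtain ⟨c', e', ν', he', hν', rfl⟩ := Λ.exists_factor ν (basisDegree i)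
      ((n - (j + 1)) • basisDegree i)
      (by rw [hν, ← succ_nsmul', show n - (j + 1) + 1 = n - j by lia])
    have h := hne j c' c e' ⟨g', ν', hg', he', by simp⟩ b e he
    cases h
    exact ⟨ν', hν', by simp⟩

theorem subsingleton_pathsFrom_of_hasNoEntrance {i : Fin k} {a : V} {μ : a ⟶ a} {n : ℕ}
    (hμ : Λ.d μ = n • basisDegree i) (hne : Λ.HasNoEntrance i μ) :
    Subsingleton (Λ.PathsFrom a (n • basisDegree i)) := by
  have key : ∀ (w : V) (f : w ⟶ a), Λ.d f = n • basisDegree i →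
      (⟨w, f⟩ : Σ w : V, (w ⟶ a)) = ⟨a, μ⟩ := by
    intro w f hf
    obtain ⟨ν, hν, h⟩ := exists_comp_eq_of_hasNoEntrance hμ hne n le_rfl f hf
    rw [Nat.sub_self, zero_smul] at hν
    cases Λ.eq_id_of_d_eq_zero ν hν
    rw [← h, Category.id_comp]
  exact Λ.subsingleton_pathsFrom fun w w' f g hf hg => (key w f hf).trans (key w' g hg).symm

/-- If `v` receives a single path of degree `m + n`, it receives a single path of degree `m`. -/
theorem subsingleton_pathsFrom_of_add (hsrc : Λ.NoSources) {v : V} {m n : Fin k → ℕ}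
    [Subsingleton (Λ.PathsFrom v (m + n))] : Subsingleton (Λ.PathsFrom v m) := by
  refine Λ.subsingleton_pathsFrom fun w w' f g hf hg => ?_
  obtain ⟨u, f', hf'⟩ := hsrc.exists_path w n
  obtain ⟨u', g', hg'⟩ := hsrc.exists_path w' n
  have h : (⟨u, f' ≫ f⟩ : Σ w : V, (w ⟶ v)) = ⟨u', g' ≫ g⟩ :=
    PathsFrom.eq (n := m + n) (by rw [Λ.d_comp, hf, hf']) (by rw [Λ.d_comp, hg, hg'])
  obtain ⟨rfl, h⟩ := Sigma.mk.inj h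
  exact Λ.prefix_unique (eq_of_heq h) (hf.trans hg.symm)

/-- Every vertex from which one can reach a cycle without entrance of colour `i` receives a single
edge of colour `i`, and lies on a closed path of colour `i`. -/
theorem single_edge_and_exists_closed (hrow : Λ.RowFinite) (hsrc : Λ.NoSources) {i : Fin k} {a : V}
    {μ : a ⟶ a} (hμ : Λ.IsCycle i μ) (hne : Λ.HasNoEntrance i μ) {w : V} (f : w ⟶ a) :
    Subsingleton (Λ.PathsFrom w (basisDegree i)) ∧
      ∃ (l : ℕ) (g : w ⟶ w), 0 < l ∧ Λ.d g = l • basisDegree i := by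
  obtain ⟨⟨n, hn, hd⟩, -⟩ := hμ
  have := subsingleton_pathsFrom_of_hasNoEntrance hd hne
  obtain ⟨h1, l, g, hl, hg⟩ := subsingleton_and_exists_closed hrow hsrc μ hd f
  refine ⟨?_, l * n, g, Nat.mul_pos hl (Nat.pos_of_ne_zero hn), by rw [hg, mul_smul]⟩
  rw [show n • (basisDegree i : Fin k → ℕ) = basisDegree i + (n - 1) • basisDegree i by
    rw [← succ_nsmul', show n - 1 + 1 = n by lia]] at h1
  exact subsingleton_pathsFrom_of_add hsrc (n := (n - 1) • basisDegree i)

/-- A closed path of colour `i` of minimal positive length is a cycle. -/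
theorem exists_isCycle {i : Fin k} {v : V}
    (h : ∃ (l : ℕ) (g : v ⟶ v), 0 < l ∧ Λ.d g = l • basisDegree i) :
    ∃ ζ : v ⟶ v, Λ.IsCycle i ζ := by
  classical
  have h' : ∃ l : ℕ, 0 < l ∧ ∃ g : v ⟶ v, Λ.d g = l • basisDegree i := by
    obtain ⟨l, g, hl, hg⟩ := h
    exact ⟨l, hl, g, hg⟩
  obtain ⟨hl, ζ, hζ⟩ := Nat.find_spec h'
  set l := Nat.find h'
  refine ⟨ζ, ⟨l, hl.ne', hζ⟩, ?_⟩
  -- cutting out the piece between two edges with the same source leaves a shorter closed path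
  have key : ∀ (j j' : ℕ) (b a a' : V) (e : b ⟶ a) (e' : b ⟶ a'),
      Λ.IsEdgeAt i ζ j e → Λ.IsEdgeAt i ζ j' e' → ¬ j < j' := by
    rintro j j' b a a' e e' ⟨μ, ν, hμ, he, -⟩ ⟨μ', ν', hμ', he', hζ'⟩ hj
    have hdeg : Λ.d ν' + (j' + 1) • basisDegree i = l • basisDegree i := by
      rw [← hζ, ← hζ', Λ.d_comp, Λ.d_comp, hμ', he', succ_nsmul, add_comm]
    have hν' : Λ.d ν' = (Λ.d ν' i) • basisDegree i := by
      funext t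
      have ht := congrFun hdeg t
      by_cases hti : t = i
      · subst hti; simp [basisDegree]
      · simp only [Pi.add_apply, Pi.smul_apply, basisDegree, Pi.single_eq_of_ne hti, smul_zero,
          add_zero] at ht
        simp [basisDegree, Pi.single_eq_of_ne hti, ht]
    have hlen : Λ.d ν' i + (j' + 1) = l := by
      apply nsmul_basisDegree_injective i
      dsimp only
      rw [add_smul, ← hν', hdeg]
    have hmin := Nat.find_min h' (m := Λ.d ν' i + (j + 1)) (show _ < l by lia)
    refine hmin ⟨by lia, ν' ≫ e ≫ μ, ?_⟩
    rw [Λ.d_comp, Λ.d_comp, hμ, he, add_smul, ← hν', succ_nsmul, add_comm]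
  intro j j' b a a' e e' h1 h2
  exact le_antisymm (not_lt.1 (key _ _ _ _ _ _ _ h2 h1)) (not_lt.1 (key _ _ _ _ _ _ _ h1 h2))

/-- If each vertex from which `v` can be reached receives a single edge of each colour, then `v`
receives a single path of each degree. -/
theorem subsingleton_pathsFrom_of_edges {v : V}
    (h : ∀ w, Nonempty (w ⟶ v) → ∀ i, Subsingleton (Λ.PathsFrom w (basisDegree i)))
    (n : Fin k → ℕ) : Subsingleton (Λ.PathsFrom v n) := by
  suffices ∀ (N : ℕ) (n : Fin k → ℕ), ∑ i, n i = N → ∀ w, Nonempty (w ⟶ v) →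
      Subsingleton (Λ.PathsFrom w n) from this _ n rfl v ⟨𝟙 v⟩
  intro N
  induction N with
  | zero =>
    intro n hn w _
    have hn0 : n = 0 := by
      funext i
      exact (Finset.sum_eq_zero_iff.1 hn) i (Finset.mem_univ i)
    subst hn0
    exact Λ.subsingleton_pathsFrom fun u u' f g hf hg =>
      (Λ.eq_id_of_d_eq_zero f hf).trans (Λ.eq_id_of_d_eq_zero g hg).symm
  | succ N ih =>
    rintro n hn w ⟨q⟩
    obtain ⟨i, hi⟩ : ∃ i, n i ≠ 0 := by
      by_contra! hcon
      simp [hcon] at hn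
    obtain ⟨n', rfl⟩ : ∃ n', n = basisDegree i + n' := by
      refine ⟨n - basisDegree i, (add_tsub_cancel_of_le fun t => ?_).symm⟩
      by_cases ht : t = i
      · subst ht; simpa [basisDegree] using Nat.one_le_iff_ne_zero.2 hi
      · simp [basisDegree, Pi.single_eq_of_ne ht]
    have hn' : ∑ t, n' t = N := by
      simp only [Pi.add_apply, Finset.sum_add_distrib] at hn
      have : ∑ t, (basisDegree i : Fin k → ℕ) t = 1 := by simp [basisDegree]
      lia
    refine Λ.subsingleton_pathsFrom fun u u' f g hf hg => ?_
    obtain ⟨c, ε, f', hε, hf', rfl⟩ := Λ.exists_factor f _ _ hf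
    obtain ⟨c', ε', g', hε', hg', rfl⟩ := Λ.exists_factor g _ _ hg
    have := h w ⟨q⟩ i
    cases PathsFrom.eq hε hε'
    have := ih n' hn' c ⟨ε ≫ q⟩
    cases PathsFrom.eq hf' hg'
    rfl

/-! ### Infinite paths -/

/-- Two infinite paths with the same initial segments are equal. -/
theorem InfinitePath.ext_of_initial {x y : Λ.InfinitePath}
    (h : ∀ n, Arrow.mk (x.path 0 n zero_le) = Arrow.mk (y.path 0 n zero_le)) : x = y := by
  have hv : x.vert = y.vert := funext fun n => congrArg (fun f : Arrow V => f.left) (h n)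
  obtain ⟨vx, px, dx, cx⟩ := x
  obtain ⟨vy, py, dy, cy⟩ := y
  dsimp only at hv h
  subst hv
  have h0 : ∀ n, px 0 n zero_le = py 0 n zero_le := fun n => by
    have := h n
    exact (Arrow.mk_inj _ _).1 this
  have hp : px = py := by
    funext m n hmn
    have h1 := cx 0 m n zero_le hmn
    have h2 := cy 0 m n zero_le hmn
    rw [h0, h0, ← h2] at h1
    exact Λ.comp_right_cancel h1
  subst hp
  rfl

theorem InfinitePath.arrow_initial_eq {x : Λ.InfinitePath} {v : V} (hx : x.vert 0 = v)
    {n : Fin k → ℕ} [Subsingleton (Λ.PathsFrom v n)] {w : V} {f : w ⟶ v} (hf : Λ.d f = n) :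
    Arrow.mk (x.path 0 n zero_le) = Arrow.mk f := by
  subst hx
  have h := PathsFrom.eq (Λ := Λ) (n := n) (f := x.path 0 n zero_le) (g := f)
    (by rw [x.d_path, tsub_zero]) hf
  exact congrArg (fun z : Σ w : V, (w ⟶ x.vert 0) => Arrow.mk z.2) h

/-- A sequence of composable paths of degree `(1, …, 1)` determines an infinite path. -/
theorem exists_infinitePath (w : ℕ → V) (f : ∀ j, w (j + 1) ⟶ w j) (hf : ∀ j, Λ.d (f j) = 1) :
    ∃ x : Λ.InfinitePath, x.vert 0 = w 0 ∧ ∀ n, ∃ j, Nonempty (w j ⟶ x.vert n) := by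
  let P : ∀ j, w j ⟶ w 0 := fun j => Nat.rec (motive := fun j => w j ⟶ w 0) (𝟙 _)
    (fun j g => f j ≫ g) j
  have hPs : ∀ j, P (j + 1) = f j ≫ P j := fun j => rfl
  have hPd : ∀ j, Λ.d (P j) = j • 1 := by
    intro j
    induction j with
    | zero => exact (Λ.d_id _).trans (zero_smul ℕ _).symm
    | succ j ih => rw [hPs, Λ.d_comp, ih, hf, succ_nsmul]
  have hPle : ∀ i j, i ≤ j → ∃ g : w j ⟶ w i, g ≫ P i = P j := by
    intro i j hij
    induction j, hij using Nat.le_induction with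
    | base => exact ⟨𝟙 _, Category.id_comp _⟩
    | succ j _ ih =>
      obtain ⟨g, hg⟩ := ih
      exact ⟨f j ≫ g, by rw [Category.assoc, hg, hPs]⟩
  let N : (Fin k → ℕ) → ℕ := fun n => ∑ i, n i
  have hN : ∀ n : Fin k → ℕ, n ≤ N n • (1 : Fin k → ℕ) := by
    intro n i
    simpa using Finset.single_le_sum (f := n) (fun _ _ => Nat.zero_le _) (Finset.mem_univ i)
  choose X Q R hQ _ hR using fun n : Fin k → ℕ => Λ.exists_factor (P (N n)) n
    (N n • 1 - n) (by rw [hPd, add_tsub_cancel_of_le (hN n)])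
  have hpath : ∀ m n : Fin k → ℕ, m ≤ n → ∃ g : X n ⟶ X m, g ≫ Q m = Q n := by
    intro m n hmn
    obtain ⟨c, q, t, hq, -, htq⟩ := Λ.exists_factor (Q n) m (n - m)
      (by rw [hQ, add_tsub_cancel_of_le hmn])
    obtain ⟨s, hs⟩ := hPle (N m) (N n) (Finset.sum_le_sum fun i _ => hmn i)
    have : (R n ≫ t) ≫ q = (s ≫ R m) ≫ Q m := by
      rw [Category.assoc, htq, hR, Category.assoc, hR, hs]
    cases Λ.prefix_unique this (hq.trans (hQ m).symm)
    exact ⟨t, htq⟩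
  choose g hg using hpath
  refine ⟨⟨X, g, fun m n h => ?_, fun m n p hmn hnp => ?_⟩, ?_, fun n => ⟨N n, ⟨R n⟩⟩⟩
  · have := congrArg Λ.d (hg m n h)
    rw [Λ.d_comp, hQ, hQ] at this
    exact eq_tsub_of_add_eq ((add_comm _ _).trans this)
  · apply Λ.comp_right_cancel (μ := Q m)
    rw [Category.assoc, hg, hg, hg]
  · exact congrArg (fun z : Σ u : V, (u ⟶ w 0) => z.1) (Λ.eq_id_of_d_eq_zero (Q 0) (hQ 0))

/-- In a cofinal graph, all sufficiently long paths into a given vertex start at vertices which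
are sources of paths into `v`.  Otherwise there would be an infinite path that never meets such a
vertex. -/
theorem Cofinal.exists_uniform (hcof : Λ.Cofinal) (hrow : Λ.RowFinite) (v w : V) :
    ∃ N : ℕ, ∀ (u : V) (f : u ⟶ w), Λ.d f = N • 1 → Nonempty (u ⟶ v) := by
  by_contra hw
  have step : ∀ w : {w : V // ¬ ∃ N : ℕ, ∀ (u : V) (f : u ⟶ w), Λ.d f = N • 1 → Nonempty (u ⟶ v)},
      ∃ (u : {w : V // ¬ ∃ N : ℕ, ∀ (u : V) (f : u ⟶ w), Λ.d f = N • 1 → Nonempty (u ⟶ v)})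
        (f : u.1 ⟶ w.1), Λ.d f = 1 := by
    rintro ⟨w, hw⟩
    by_contra! hcon
    apply hw
    have h1 : ∀ p : Λ.PathsFrom w 1, ∃ N : ℕ, ∀ (u : V) (f : u ⟶ p.1.1), Λ.d f = N • 1 →
        Nonempty (u ⟶ v) := by
      rintro ⟨⟨u, f⟩, hf⟩
      by_contra hu
      exact hcon ⟨u, hu⟩ f hf
    choose N hN using h1
    have := hrow w 1
    obtain ⟨M, hM⟩ := (Set.finite_range N).bddAbove
    refine ⟨M + 1, fun u f hf => ?_⟩
    obtain ⟨c, p, g, hp, hg, rfl⟩ := Λ.exists_factor f 1 (M • 1) (by rw [hf, succ_nsmul'])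
    have hle : N ⟨⟨c, p⟩, hp⟩ ≤ M := hM ⟨_, rfl⟩
    obtain ⟨c', p', g', hp', -, rfl⟩ := Λ.exists_factor g (N ⟨⟨c, p⟩, hp⟩ • 1)
      ((M - N ⟨⟨c, p⟩, hp⟩) • 1) (by rw [hg, ← add_smul, Nat.add_sub_cancel' hle])
    obtain ⟨q⟩ := hN ⟨⟨c, p⟩, hp⟩ c' p' hp'
    exact ⟨g' ≫ q⟩
  choose next f hf using step
  let W : ℕ → {w : V // ¬ ∃ N : ℕ, ∀ (u : V) (f : u ⟶ w), Λ.d f = N • 1 → Nonempty (u ⟶ v)} :=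
    fun j => next^[j] ⟨w, hw⟩
  have hW : ∀ j, W (j + 1) = next (W j) := fun j => Function.iterate_succ_apply' _ _ _
  have hstep : ∀ j, ∃ g : (W (j + 1)).1 ⟶ (W j).1, Λ.d g = 1 := by
    intro j
    rw [hW]
    exact ⟨f _, hf _⟩
  choose g hg using hstep
  obtain ⟨x, -, hx⟩ := exists_infinitePath (fun j => (W j).1) g hg
  obtain ⟨n, ⟨q⟩⟩ := hcof v x
  obtain ⟨j, ⟨r⟩⟩ := hx n
  refine (W j).2 ⟨0, fun u h _ => ?_⟩
  exact ⟨h ≫ r ≫ q⟩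

theorem NoSources.exists_infinitePath (hsrc : Λ.NoSources) (v : V) :
    ∃ x : Λ.InfinitePath, x.vert 0 = v := by
  choose next f hf using fun w : V => hsrc.exists_path w 1
  have hstep : ∀ j, ∃ g : next^[j + 1] v ⟶ next^[j] v, Λ.d g = 1 := by
    intro j
    rw [Function.iterate_succ_apply']
    exact ⟨f _, hf _⟩
  choose g hg using hstep
  obtain ⟨x, hx, -⟩ := KGraph.exists_infinitePath (fun j => next^[j] v) g hg
  exact ⟨x, hx⟩

end KGraph

namespace KGraph

variable {k : ℕ} {V : Type u} [Category.{v} V] {Λ : KGraph k V} {v : V}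

/-! ### Periodic vertices and their tail classes -/

variable (Λ v) in
/-- The vertex `v` receives exactly one infinite path, this path returns to `v` in the direction
`(1, …, 1)`, and each infinite path of the graph meets it. -/
structure IsPeriodicVertex : Prop where
  subsingleton : ∀ n, Subsingleton (Λ.PathsFrom v n)
  exists_closed : ∃ η : v ⟶ v, ∀ i, Λ.d η i ≠ 0
  uniform : ∀ w : V, ∃ N : ℕ, ∀ (u : V) (f : u ⟶ w), Λ.d f = N • 1 → Nonempty (u ⟶ v)

namespace IsPeriodicVertex

theorem comp_comm (h : Λ.IsPeriodicVertex v) (f g : v ⟶ v) : f ≫ g = g ≫ f := by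
  have := h.subsingleton (Λ.d f + Λ.d g)
  have := PathsFrom.eq (Λ := Λ) (n := Λ.d f + Λ.d g) (f := f ≫ g) (g := g ≫ f)
    (by rw [Λ.d_comp, add_comm]) (Λ.d_comp _ _)
  simpa using this

theorem eq_of_d_eq (h : Λ.IsPeriodicVertex v) {w w' : V} {f : w ⟶ v} {g : w' ⟶ v}
    (hd : Λ.d f = Λ.d g) : (⟨w, f⟩ : Σ w : V, (w ⟶ v)) = ⟨w', g⟩ :=
  have := h.subsingleton (Λ.d g)
  PathsFrom.eq (n := Λ.d g) hd rfl

theorem exists_closed_ge (h : Λ.IsPeriodicVertex v) (n : Fin k → ℕ) :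
    ∃ η : v ⟶ v, n ≤ Λ.d η := by
  obtain ⟨η, hη⟩ := h.exists_closed
  refine ⟨closedPathPow η (∑ i, n i), fun i => ?_⟩
  rw [Λ.d_closedPathPow, Pi.smul_apply, smul_eq_mul]
  calc n i ≤ ∑ i, n i := Finset.single_le_sum (f := n) (fun _ _ => Nat.zero_le _) (Finset.mem_univ i)
    _ ≤ _ := Nat.le_mul_of_pos_right _ (Nat.pos_of_ne_zero (hη i))

/-- Each vertex on the infinite path at `v` can be reached back from `v`. -/
theorem exists_return (h : Λ.IsPeriodicVertex v) {w : V} (q : w ⟶ v) : Nonempty (v ⟶ w) := by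
  obtain ⟨η, hη⟩ := h.exists_closed_ge (Λ.d q)
  obtain ⟨c, q', t, hq', -, -⟩ := Λ.exists_factor η (Λ.d q) (Λ.d η - Λ.d q)
    (add_tsub_cancel_of_le hη).symm
  cases h.eq_of_d_eq hq'
  exact ⟨t⟩

theorem subsingleton_of_hom (h : Λ.IsPeriodicVertex v) {w : V} (q : w ⟶ v) (n : Fin k → ℕ) :
    Subsingleton (Λ.PathsFrom w n) := by
  refine Λ.subsingleton_pathsFrom fun u u' f g hf hg => ?_
  have := h.eq_of_d_eq (f := f ≫ q) (g := g ≫ q) (by rw [Λ.d_comp, Λ.d_comp, hf, hg])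
  obtain ⟨rfl, h⟩ := Sigma.mk.inj this
  rw [Λ.comp_right_cancel (eq_of_heq h)]

/-- Every path from `v` can be extended at `v` so that it has an initial segment of a prescribed
degree. -/
theorem exists_extend (h : Λ.IsPeriodicVertex v) {w : V} (f : v ⟶ w) (n : Fin k → ℕ) :
    ∃ (α : v ⟶ v) (p : Λ.PathsFrom w n) (g : v ⟶ p.1.1), g ≫ p.1.2 = α ≫ f := by
  obtain ⟨η, hη⟩ := h.exists_closed_ge n
  have hle : n ≤ Λ.d (η ≫ f) := by
    rw [Λ.d_comp]
    exact hη.trans (le_add_self)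
  obtain ⟨c, p, g, hp, -, hg⟩ := Λ.exists_factor (η ≫ f) n (Λ.d (η ≫ f) - n)
    (add_tsub_cancel_of_le hle).symm
  exact ⟨η, ⟨⟨c, p⟩, hp⟩, g, hg⟩

/-- Two paths `f, g` from `v` to `w` are tail equivalent if `fα = gβ` for some closed paths
`α, β` at `v`, that is, if they extend to the same infinite path. -/
def tailSetoid (h : Λ.IsPeriodicVertex v) (w : V) : Setoid (v ⟶ w) where
  r f g := ∃ α β : v ⟶ v, α ≫ f = β ≫ g
  iseqv :=
    { refl := fun f => ⟨𝟙 v, 𝟙 v, rfl⟩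
      symm := fun ⟨α, β, h⟩ => ⟨β, α, h.symm⟩
      trans := by
        rintro f g l ⟨α, β, h1⟩ ⟨γ, δ, h2⟩
        refine ⟨γ ≫ α, β ≫ δ, ?_⟩
        rw [Category.assoc, h1, ← Category.assoc, h.comp_comm γ β, Category.assoc, h2,
          Category.assoc] }

/-- The infinite paths with range `w`, encoded as the tail equivalence classes of paths from `v` to
`w`. -/
def TailClass (h : Λ.IsPeriodicVertex v) (w : V) : Type v := Quotient (h.tailSetoid w)

/-- The class of a path from `v`. -/
def tail (h : Λ.IsPeriodicVertex v) {w : V} (f : v ⟶ w) : h.TailClass w :=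
  Quotient.mk (h.tailSetoid w) f

theorem tail_surjective (h : Λ.IsPeriodicVertex v) {w : V} (j : h.TailClass w) :
    ∃ f : v ⟶ w, h.tail f = j :=
  Quotient.exists_rep j

theorem tail_eq_tail (h : Λ.IsPeriodicVertex v) {w : V} {f g : v ⟶ w} :
    h.tail f = h.tail g ↔ ∃ α β : v ⟶ v, α ≫ f = β ≫ g :=
  Quotient.eq (r := h.tailSetoid w)

/-- Composition with a path from the left. -/
def act (h : Λ.IsPeriodicVertex v) {u w : V} (f : u ⟶ w) : h.TailClass u → h.TailClass w :=
  Quotient.map (· ≫ f) (by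
    rintro a b ⟨α, β, hab⟩
    exact ⟨α, β, by rw [← Category.assoc, hab, Category.assoc]⟩)

theorem act_tail (h : Λ.IsPeriodicVertex v) {u w : V} (f : u ⟶ w) (g : v ⟶ u) :
    h.act f (h.tail g) = h.tail (g ≫ f) := rfl

theorem act_id (h : Λ.IsPeriodicVertex v) {w : V} (j : h.TailClass w) : h.act (𝟙 w) j = j := by
  obtain ⟨f, rfl⟩ := h.tail_surjective j
  rw [act_tail, Category.comp_id]

theorem act_comp (h : Λ.IsPeriodicVertex v) {u w z : V} (f : u ⟶ w) (g : w ⟶ z)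
    (j : h.TailClass u) : h.act (f ≫ g) j = h.act g (h.act f j) := by
  obtain ⟨f, rfl⟩ := h.tail_surjective j
  simp only [act_tail, Category.assoc]

theorem act_injective (h : Λ.IsPeriodicVertex v) {u w : V} (f : u ⟶ w) :
    Function.Injective (h.act f) := by
  intro i j hij
  obtain ⟨a, rfl⟩ := h.tail_surjective i
  obtain ⟨b, rfl⟩ := h.tail_surjective j
  rw [act_tail, act_tail, tail_eq_tail] at hij
  obtain ⟨α, β, hab⟩ := hij
  rw [tail_eq_tail]
  exact ⟨α, β, Λ.comp_right_cancel (μ := f) (by simpa using hab)⟩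

/-- Each infinite path with range `w` has exactly one initial segment of degree `n`. -/
theorem act_bijective (h : Λ.IsPeriodicVertex v) (w : V) (n : Fin k → ℕ) :
    Function.Bijective fun z : Σ p : Λ.PathsFrom w n, h.TailClass p.1.1 => h.act z.1.1.2 z.2 := by
  constructor
  · rintro ⟨⟨⟨c, p⟩, hp⟩, i⟩ ⟨⟨⟨c', p'⟩, hp'⟩, i'⟩ hij
    obtain ⟨a, rfl⟩ := h.tail_surjective i
    obtain ⟨a', rfl⟩ := h.tail_surjective i'
    dsimp only at a a' hij
    rw [act_tail, act_tail, tail_eq_tail] at hij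
    obtain ⟨α, β, hab⟩ := hij
    have hab' : (α ≫ a) ≫ p = (β ≫ a') ≫ p' := by simpa using hab
    cases Λ.prefix_unique hab' (hp.trans hp'.symm)
    have : h.tail a = h.tail a' := h.tail_eq_tail.2 ⟨α, β, Λ.comp_right_cancel hab'⟩
    rw [this]
  · intro j
    obtain ⟨f, rfl⟩ := h.tail_surjective j
    obtain ⟨α, p, g, hg⟩ := h.exists_extend f n
    refine ⟨⟨p, h.tail g⟩, ?_⟩
    dsimp only
    rw [act_tail, hg, tail_eq_tail]
    exact ⟨𝟙 v, α, Category.id_comp _⟩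

/-- A vertex on the infinite path at `v` receives only one infinite path. -/
theorem subsingleton_tailClass (h : Λ.IsPeriodicVertex v) {w : V} (q : w ⟶ v) :
    Subsingleton (h.TailClass w) := by
  refine ⟨fun i j => ?_⟩
  obtain ⟨f, rfl⟩ := h.tail_surjective i
  obtain ⟨g, rfl⟩ := h.tail_surjective j
  rw [tail_eq_tail]
  refine ⟨g ≫ q, f ≫ q, Λ.comp_right_cancel (μ := q) ?_⟩
  simpa using h.comp_comm (g ≫ q) (f ≫ q)

theorem finite_tailClass (h : Λ.IsPeriodicVertex v) (hrow : Λ.RowFinite) (w : V) :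
    Finite (h.TailClass w) := by
  obtain ⟨N, hN⟩ := h.uniform w
  have := hrow w (N • 1)
  have : ∀ p : Λ.PathsFrom w (N • 1), Finite (h.TailClass p.1.1) := fun p => by
    obtain ⟨q⟩ := hN p.1.1 p.1.2 p.2
    have := h.subsingleton_tailClass q
    infer_instance
  exact Finite.of_surjective _ (h.act_bijective w (N • 1)).surjective

theorem countable_sigma_tailClass (h : Λ.IsPeriodicVertex v) :
    Countable (Σ w : V, h.TailClass w) := by
  have := Λ.countable_vertices
  have := Λ.countable_paths
  have : ∀ w, Countable (h.TailClass w) := fun w =>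
    Function.Surjective.countable (f := h.tail (w := w)) h.tail_surjective
  infer_instance

end IsPeriodicVertex

/-! ### The representation on the infinite paths -/

section PathRepresentation

/-- The character of `ℕ^k` with values `c i` at the generators. -/
noncomputable def degreeChar (c : Fin k → Circle) (n : Fin k → ℕ) : ℂ := ((∏ i, c i ^ n i : Circle) : ℂ)

theorem degreeChar_zero (c : Fin k → Circle) : degreeChar c 0 = 1 := by simp [degreeChar]

theorem degreeChar_add (c : Fin k → Circle) (m n : Fin k → ℕ) :
    degreeChar c (m + n) = degreeChar c m * degreeChar c n := by
  simp only [degreeChar, Pi.add_apply, pow_add, Finset.prod_mul_distrib, Circle.coe_mul]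

theorem degreeChar_mul_star (c : Fin k → Circle) (n : Fin k → ℕ) :
    degreeChar c n * star (degreeChar c n) = 1 := by
  simp [degreeChar, Complex.mul_conj, Circle.normSq_coe]

variable {D : Type*} [NonUnitalCStarAlgebra D]

/-- The Cuntz--Krieger family of the paths acting on matrix units indexed by the infinite paths:
`S_f = c^{d(f)} ∑ E_{fx, x}`, the sum running over the finitely many infinite paths `x` with range
`s(f)`. -/
noncomputable def IsPeriodicVertex.pathFamily (h : Λ.IsPeriodicVertex v) (hrow : Λ.RowFinite)
    (c : Fin k → Circle) (E : MatrixSystem (Σ w : V, h.TailClass w) ℂ D) : Λ.CKFamily D :=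
  have := h.finite_tailClass hrow
  letI : ∀ w, Fintype (h.TailClass w) := fun w => Fintype.ofFinite _
  have hid : ∀ v, ∑ i : h.TailClass v, E.e ⟨v, h.act (𝟙 v) i⟩ ⟨v, i⟩ (degreeChar c (Λ.d (𝟙 v))) =
      ∑ i : h.TailClass v, E.e ⟨v, i⟩ ⟨v, i⟩ 1 := fun v => by
    simp only [h.act_id, Λ.d_id, degreeChar_zero]
  have hsum : ∀ {a b : V} (x : h.TailClass a → D) (y : h.TailClass b → D)
      (_ : ∀ i j, (⟨a, i⟩ : Σ w : V, h.TailClass w) ≠ ⟨b, j⟩ → x i * y j = 0), a ≠ b →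
      (∑ i, x i) * (∑ j, y j) = 0 := by
    intro a b x y h1 hab
    simp only [Finset.sum_mul, Finset.mul_sum]
    exact Finset.sum_eq_zero fun i _ => Finset.sum_eq_zero fun j _ => h1 _ _ (by
      intro he
      exact hab (congrArg Sigma.fst he))
  have hne : ∀ {a : V} {i j : h.TailClass a}, i ≠ j → (⟨a, i⟩ : Σ w : V, h.TailClass w) ≠ ⟨a, j⟩ :=
    fun hij he => hij (by simpa using he)
  { S := fun {w v} f => ∑ i : h.TailClass w, E.e ⟨v, h.act f i⟩ ⟨w, i⟩ (degreeChar c (Λ.d f))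
    isStarProjection := fun v => by
      rw [hid]
      constructor
      · change _ * _ = _
        rw [Finset.sum_mul]
        refine Finset.sum_congr rfl fun i _ => ?_
        rw [Finset.mul_sum, Finset.sum_eq_single i, E.mul_same, one_mul]
        · intro j _ hj
          exact E.mul_ne _ _ _ _ _ _ (hne hj.symm)
        · simp
      · change star _ = _
        simp [star_sum, E.star_e]
    orthogonal := fun v w hvw => by
      rw [hid, hid]
      exact hsum _ _ (fun i j hij => E.mul_ne _ _ _ _ _ _ hij) hvw
    mul := fun {u w v} μ ν => by
      rw [Finset.mul_sum]
      refine Finset.sum_congr rfl fun i _ => ?_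
      rw [Finset.sum_mul, Finset.sum_eq_single (h.act ν i), E.mul_same, h.act_comp, Λ.d_comp,
        degreeChar_add]
      · intro j _ hj
        exact E.mul_ne _ _ _ _ _ _ (hne hj)
      · simp
    star_mul_self := fun {w v} μ => by
      rw [hid, star_sum, Finset.sum_mul]
      refine Finset.sum_congr rfl fun i _ => ?_
      rw [Finset.mul_sum, Finset.sum_eq_single i, E.star_e, E.mul_same, mul_comm,
        degreeChar_mul_star]
      · intro j _ hj
        rw [E.star_e]
        exact E.mul_ne _ _ _ _ _ _ (hne ((h.act_injective μ).ne hj.symm))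
      · simp
    sum_eq := fun v n _ => by
      rw [hid, ← Fintype.sum_bijective _ (h.act_bijective v n)
        (fun z => E.e ⟨v, h.act z.1.1.2 z.2⟩ ⟨v, h.act z.1.1.2 z.2⟩ 1) _ (fun _ => rfl),
        Fintype.sum_sigma]
      refine Finset.sum_congr rfl fun p _ => ?_
      rw [Finset.sum_mul]
      refine Finset.sum_congr rfl fun i _ => ?_
      rw [star_sum, Finset.mul_sum, Finset.sum_eq_single i, E.star_e, E.mul_same,
        degreeChar_mul_star]
      · intro j _ hj
        rw [E.star_e]
        exact E.mul_ne _ _ _ _ _ _ (hne hj.symm)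
      · simp }

/-- A closed path at `v` acts on the only infinite path at `v` as a scalar. -/
theorem IsPeriodicVertex.pathFamily_S_closed (h : Λ.IsPeriodicVertex v) (hrow : Λ.RowFinite)
    (c : Fin k → Circle) (E : MatrixSystem (Σ w : V, h.TailClass w) ℂ D) (f : v ⟶ v) :
    (h.pathFamily hrow c E).S f = E.e ⟨v, h.tail (𝟙 v)⟩ ⟨v, h.tail (𝟙 v)⟩ (degreeChar c (Λ.d f)) := by
  have := h.subsingleton_tailClass (𝟙 v)
  let _ := h.finite_tailClass hrow
  let _ : ∀ w, Fintype (h.TailClass w) := fun w => Fintype.ofFinite _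
  change ∑ i : h.TailClass v, E.e ⟨v, h.act f i⟩ ⟨v, i⟩ (degreeChar c (Λ.d f)) = _
  rw [Fintype.sum_subsingleton _ (h.tail (𝟙 v)), Subsingleton.elim (h.act f _) (h.tail (𝟙 v))]

end PathRepresentation

end KGraph

namespace KGraph

variable {k : ℕ} {V : Type u} [Category.{v} V] {Λ : KGraph k V} {v : V}

/-! ### Cuntz--Krieger relations -/

namespace CKFamily

variable {A : Type w} [NonUnitalCStarAlgebra A] (F : Λ.CKFamily A)

theorem star_S_id (v : V) : star (F.S (𝟙 v)) = F.S (𝟙 v) :=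
  (F.isStarProjection v).isSelfAdjoint.star_eq

theorem S_mul_id {w v : V} (μ : w ⟶ v) : F.S μ * F.S (𝟙 w) = F.S μ := by
  rw [F.mul, Category.id_comp]

theorem id_mul_S {w v : V} (μ : w ⟶ v) : F.S (𝟙 v) * F.S μ = F.S μ := by
  rw [F.mul, Category.comp_id]

theorem id_mul_star_S {w v : V} (μ : w ⟶ v) : F.S (𝟙 w) * star (F.S μ) = star (F.S μ) := by
  rw [← F.star_S_id, ← star_mul, F.S_mul_id]

theorem star_S_mul_id {w v : V} (μ : w ⟶ v) : star (F.S μ) * F.S (𝟙 v) = star (F.S μ) := by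
  rw [← F.star_S_id, ← star_mul, F.id_mul_S]

theorem star_S_mul_S_of_range_ne {u u' w w' : V} (μ : u ⟶ w) (ν : u' ⟶ w') (h : w ≠ w') :
    star (F.S μ) * F.S ν = 0 := by
  rw [← F.star_S_mul_id μ, ← F.id_mul_S ν, mul_assoc, ← mul_assoc (F.S (𝟙 w)), F.orthogonal _ _ h,
    zero_mul, mul_zero]

/-- Different paths of the same degree have orthogonal range projections, because the sum of these
projections is again a projection. -/
theorem star_S_mul_S_of_ne (hrow : Λ.RowFinite) {u u' w : V} (μ : u ⟶ w) (ν : u' ⟶ w)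
    (hd : Λ.d μ = Λ.d ν) (h : (⟨u, μ⟩ : Σ u : V, (u ⟶ w)) ≠ ⟨u', ν⟩) :
    star (F.S μ) * F.S ν = 0 := by
  classical
  have := hrow w (Λ.d ν)
  let _ := Fintype.ofFinite (Λ.PathsFrom w (Λ.d ν))
  let _ := CStarAlgebra.spectralOrder A
  let _ := CStarAlgebra.spectralOrderedRing A
  set q := F.S ν * star (F.S ν) with hq
  have hqs : star q = q := by rw [hq, star_mul, star_star]
  have hqq : q * q = q := by
    rw [hq, mul_assoc, ← mul_assoc (star (F.S ν)), F.star_mul_self, F.id_mul_star_S]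
  have hpq : F.S (𝟙 w) * q = q := by rw [hq, ← mul_assoc, F.id_mul_S]
  let t : Λ.PathsFrom w (Λ.d ν) → A := fun p => star (star (F.S p.1.2) * q) * (star (F.S p.1.2) * q)
  have ht : ∀ p, t p = q * (F.S p.1.2 * star (F.S p.1.2)) * q := fun p => by
    simp only [t, star_mul, star_star, hqs, mul_assoc]
  have hsum : q = ∑ p, t p := by
    simp only [ht]
    rw [← Finset.sum_mul, ← Finset.mul_sum, ← F.sum_eq, mul_assoc, hpq, hqq]
  let p₀ : Λ.PathsFrom w (Λ.d ν) := ⟨⟨u', ν⟩, rfl⟩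
  have h0 : t p₀ = q := by
    rw [ht]
    change q * q * q = q
    rw [hqq, hqq]
  rw [← Finset.add_sum_erase _ _ (Finset.mem_univ p₀), h0, eq_comm, add_eq_left,
    Finset.sum_eq_zero_iff_of_nonneg (fun p _ => star_mul_self_nonneg _)] at hsum
  have h1 := hsum ⟨⟨u, μ⟩, hd⟩ (Finset.mem_erase.2 ⟨fun he => h (Subtype.ext_iff.1 he),
    Finset.mem_univ _⟩)
  have h2 : star (F.S μ) * q = 0 := CStarRing.star_mul_self_eq_zero_iff _ |>.1 h1
  calc star (F.S μ) * F.S ν = star (F.S μ) * q * F.S ν := by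
        rw [hq, mul_assoc, mul_assoc (F.S ν), F.star_mul_self, F.S_mul_id]
    _ = 0 := by rw [h2, zero_mul]

theorem S_mul_star_S {w v : V} (μ : w ⟶ v) [Subsingleton (Λ.PathsFrom v (Λ.d μ))] :
    F.S μ * star (F.S μ) = F.S (𝟙 v) := by
  let _ : Unique (Λ.PathsFrom v (Λ.d μ)) := ⟨⟨⟨⟨w, μ⟩, rfl⟩⟩, fun _ => Subsingleton.elim _ _⟩
  rw [F.sum_eq v (Λ.d μ), Fintype.sum_unique]
  rfl

/-! ### Cuntz--Krieger families and tail classes -/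

section Periodic

variable (h : Λ.IsPeriodicVertex v)
include h

theorem closed_mul_star (α : v ⟶ v) : F.S α * star (F.S α) = F.S (𝟙 v) :=
  have := h.subsingleton (Λ.d α)
  F.S_mul_star_S α

theorem star_S_closed_comm (α β : v ⟶ v) : star (F.S α) * F.S β = F.S β * star (F.S α) := by
  calc star (F.S α) * F.S β = star (F.S α) * (F.S β * F.S α) * star (F.S α) := by
        rw [mul_assoc, mul_assoc (F.S β), F.closed_mul_star h, F.S_mul_id]
    _ = star (F.S α) * (F.S α * F.S β) * star (F.S α) := by rw [F.mul, F.mul, h.comp_comm]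
    _ = F.S β * star (F.S α) := by
        rw [← mul_assoc (star _), F.star_mul_self, F.id_mul_S]

theorem S_eq_of_comp_eq {w : V} {f g : v ⟶ w} {α β : v ⟶ v} (hfg : α ≫ f = β ≫ g) :
    F.S f = F.S g * (F.S β * star (F.S α)) := by
  rw [← mul_assoc, F.mul, ← hfg, ← F.mul, mul_assoc, F.closed_mul_star h, F.S_mul_id]

theorem star_S_mul_S_of_tail_eq {w : V} {f g : v ⟶ w} (hfg : h.tail f = h.tail g) :
    ∃ α β : v ⟶ v, star (F.S f) * F.S g = F.S α * star (F.S β) := by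
  obtain ⟨α, β, hab⟩ := h.tail_eq_tail.1 hfg
  refine ⟨α, β, ?_⟩
  rw [F.S_eq_of_comp_eq h hab, star_mul, star_mul, star_star, mul_assoc, F.star_mul_self, mul_assoc,
    F.star_S_mul_id]

theorem star_S_mul_S_of_tail_ne (hrow : Λ.RowFinite) (hsrc : Λ.NoSources) {w w' : V} {f : v ⟶ w}
    {g : v ⟶ w'} (hfg : (⟨w, h.tail f⟩ : Σ w : V, h.TailClass w) ≠ ⟨w', h.tail g⟩) :
    star (F.S f) * F.S g = 0 := by
  by_cases hw : w = w'
  · subst hw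
    -- extend `f` and `g` at `v` to paths of the same degree
    obtain ⟨u, α, hα⟩ := hsrc.exists_path v (Λ.d g)
    obtain ⟨u', β, hβ⟩ := hsrc.exists_path v (Λ.d f)
    have hαα : F.S α * star (F.S α) = F.S (𝟙 v) :=
      have := h.subsingleton (Λ.d α)
      F.S_mul_star_S α
    have hββ : F.S β * star (F.S β) = F.S (𝟙 v) :=
      have := h.subsingleton (Λ.d β)
      F.S_mul_star_S β
    have h0 : star (F.S (α ≫ f)) * F.S (β ≫ g) = 0 := by
      refine F.star_S_mul_S_of_ne hrow _ _ (by rw [Λ.d_comp, Λ.d_comp, hα, hβ, add_comm]) ?_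
      intro he
      obtain ⟨rfl, he⟩ := Sigma.mk.inj he
      obtain ⟨τ⟩ := h.exists_return α
      refine hfg (congrArg _ (h.tail_eq_tail.2 ⟨τ ≫ α, τ ≫ β, ?_⟩))
      rw [Category.assoc, Category.assoc, eq_of_heq he]
    calc star (F.S f) * F.S g
        = star (F.S f * (F.S α * star (F.S α))) * (F.S g * (F.S β * star (F.S β))) := by
          rw [hαα, hββ, F.S_mul_id, F.S_mul_id]
      _ = F.S α * (star (F.S f * F.S α) * (F.S g * F.S β)) * star (F.S β) := by
          simp only [star_mul, star_star, mul_assoc]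
      _ = 0 := by rw [F.mul, F.mul, h0, mul_zero, zero_mul]
  · exact F.star_S_mul_S_of_range_ne f g hw

theorem S_mul_star_mul_S_mul_star (hrow : Λ.RowFinite) (hsrc : Λ.NoSources) {a b c e : V} (f : v ⟶ a)
    (g : v ⟶ b) (f' : v ⟶ c) (g' : v ⟶ e) :
    F.S f * star (F.S g) * (F.S f' * star (F.S g')) = 0 ∨
      ∃ α β : v ⟶ v,
        F.S f * star (F.S g) * (F.S f' * star (F.S g')) = F.S (α ≫ f) * star (F.S (β ≫ g')) := by
  have hassoc : F.S f * star (F.S g) * (F.S f' * star (F.S g')) =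
      F.S f * (star (F.S g) * F.S f') * star (F.S g') := by simp only [mul_assoc]
  rw [hassoc]
  by_cases hgf : (⟨b, h.tail g⟩ : Σ w : V, h.TailClass w) = ⟨c, h.tail f'⟩
  · right
    obtain ⟨rfl, hgf⟩ := Sigma.mk.inj hgf
    obtain ⟨α, β, hab⟩ := F.star_S_mul_S_of_tail_eq h (eq_of_heq hgf)
    refine ⟨α, β, ?_⟩
    rw [hab, ← F.mul, ← F.mul, star_mul]
    simp only [mul_assoc]
  · left
    rw [F.star_S_mul_S_of_tail_ne h hrow hsrc hgf, mul_zero, zero_mul]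

/-- Each generator lies in the span of the elements `s_f s_g^*` with `f, g` paths from `v`. -/
theorem S_mem_span (hrow : Λ.RowFinite) {u w : V} (f : u ⟶ w) :
    F.S f ∈ Submodule.span ℂ
      {x : A | ∃ (a b : V) (f : v ⟶ a) (g : v ⟶ b), x = F.S f * star (F.S g)} := by
  obtain ⟨N, hN⟩ := h.uniform u
  have := hrow u (N • 1)
  let _ := Fintype.ofFinite (Λ.PathsFrom u (N • 1))
  rw [← F.S_mul_id f, F.sum_eq u (N • 1), Finset.mul_sum]
  refine Submodule.sum_mem _ fun p _ => Submodule.subset_span ?_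
  obtain ⟨q⟩ := hN p.1.1 p.1.2 p.2
  obtain ⟨τ⟩ := h.exists_return q
  refine ⟨w, u, τ ≫ p.1.2 ≫ f, τ ≫ p.1.2, ?_⟩
  have := h.subsingleton_of_hom q (Λ.d τ)
  have hτ := F.S_mul_star_S τ
  rw [← F.mul (p.1.2 ≫ f), ← F.mul p.1.2 τ, star_mul, mul_assoc, ← mul_assoc (F.S τ), hτ,
    F.id_mul_star_S, ← F.mul f, mul_assoc]

end Periodic

end CKFamily

/-! ### The universal family -/

variable (Λ) in
/-- The generators of `C*(Λ)` form a Cuntz--Krieger family. -/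
noncomputable def universalFamily : Λ.CKFamily Λ.CStar where
  S f := Λ.s f
  isStarProjection := Λ.isStarProjection_p
  orthogonal v w h := Subtype.ext (lp.ext (funext fun π => π.family.orthogonal v w h))
  mul μ ν := Subtype.ext (lp.ext (funext fun π => π.family.mul μ ν))
  star_mul_self μ := Subtype.ext (lp.ext (funext fun π => π.family.star_mul_self μ))
  sum_eq v n _ := by
    refine Subtype.ext (lp.ext (funext fun π => (π.family.sum_eq v n).trans ?_))
    let φ : Λ.CStar →+ π.Carrier :=
      { toFun := fun x => (x.1 : ∀ π : Λ.Representation, π.Carrier) π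
        map_zero' := rfl
        map_add' := fun _ _ => rfl }
    exact (map_sum φ (fun p : Λ.PathsFrom v n => Λ.s p.1.2 * star (Λ.s p.1.2)) Finset.univ).symm

/-- The *-homomorphism on `C*(Λ)` induced by a Cuntz--Krieger family. -/
noncomputable def CKFamily.lift {A : Type} [NonUnitalCStarAlgebra A] (F : Λ.CKFamily A) :
    Λ.CStar →⋆ₙₐ[ℂ] A where
  toFun x := (x.1 : ∀ π : Λ.Representation, π.Carrier) ⟨A, F⟩
  map_smul' _ _ := rfl
  map_zero' := rfl
  map_add' _ _ := rfl
  map_mul' _ _ := rfl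
  map_star' _ := rfl

variable (Λ) in
/-- The inclusion of `C*(Λ)` in the algebra of bounded families. -/
noncomputable def cstarInclusion : Λ.CStar →⋆ₙₐ[ℂ] Λ.BoundedFamilies :=
  NonUnitalStarSubalgebraClass.subtype Λ.universalSubalgebra

theorem isInducing_cstarInclusion : Topology.IsInducing Λ.cstarInclusion :=
  Topology.IsInducing.subtypeVal

/-- `C*(Λ)` is the closed span of the elements `s_f s_g^*` with `f, g` paths from `v`: this span
is a *-algebra that contains the generators. -/
theorem dense_span_S_mul_star (h : Λ.IsPeriodicVertex v) (hrow : Λ.RowFinite) (hsrc : Λ.NoSources) :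
    Dense (Submodule.span ℂ {x : Λ.CStar | ∃ (a b : V) (f : v ⟶ a) (g : v ⟶ b),
      x = Λ.universalFamily.S f * star (Λ.universalFamily.S g)} : Set Λ.CStar) := by
  set F := Λ.universalFamily with hF
  set W := Submodule.span ℂ {x : Λ.CStar | ∃ (a b : V) (f : v ⟶ a) (g : v ⟶ b),
      x = F.S f * star (F.S g)} with hW
  let B : NonUnitalStarSubalgebra ℂ Λ.CStar :=
    { W with
      mul_mem' := by
        intro x y hx hy
        refine Submodule.span_induction₂ (p := fun x y _ _ => x * y ∈ W) ?_ ?_ ?_ ?_ ?_ ?_ ?_ hx hy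
        · rintro _ _ ⟨a, b, f, g, rfl⟩ ⟨c, e, f', g', rfl⟩
          obtain h0 | ⟨α, β, h0⟩ := F.S_mul_star_mul_S_mul_star h hrow hsrc f g f' g'
          · rw [h0]; exact zero_mem _
          · rw [h0]; exact Submodule.subset_span ⟨_, _, _, _, rfl⟩
        · intro y _; simp
        · intro x _; simp
        · intro x y z _ _ _ h1 h2; rw [add_mul]; exact add_mem h1 h2
        · intro x y z _ _ _ h1 h2; rw [mul_add]; exact add_mem h1 h2
        · intro r x y _ _ h; rw [smul_mul_assoc]; exact Submodule.smul_mem _ r h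
        · intro r x y _ _ h; rw [mul_smul_comm]; exact Submodule.smul_mem _ r h
      star_mem' := by
        intro x hx
        refine Submodule.span_induction (p := fun x _ => star x ∈ W) ?_ ?_ ?_ ?_ hx
        · rintro _ ⟨a, b, f, g, rfl⟩
          rw [star_mul, star_star]
          exact Submodule.subset_span ⟨_, _, _, _, rfl⟩
        · simp
        · intro x y _ _ h1 h2; rw [star_add]; exact add_mem h1 h2
        · intro r x _ h; rw [star_smul]; exact Submodule.smul_mem _ _ h }
  have hle : NonUnitalStarAlgebra.adjoin ℂ
      {a : Λ.BoundedFamilies | ∃ (w v : V) (μ : w ⟶ v), a = Λ.generator μ} ≤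
        B.map Λ.cstarInclusion := by
    rw [NonUnitalStarAlgebra.adjoin_le_iff]
    rintro _ ⟨u, w, μ, rfl⟩
    exact ⟨Λ.s μ, F.S_mem_span h hrow μ, rfl⟩
  have hcl : ∀ x : Λ.CStar, Λ.cstarInclusion x ∈ closure (Λ.cstarInclusion '' (W : Set Λ.CStar)) :=
    fun x => closure_mono (fun z hz => by
      obtain ⟨y, hy, rfl⟩ := hle hz
      exact ⟨y, hy, rfl⟩) x.2
  intro x
  rw [isInducing_cstarInclusion.closure_eq_preimage_closure_image]
  exact hcl x

end KGraph

/-! ### Commutative C*-algebras generated by two unitaries -/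

section Torus

/-- The values of a character on the unitary group. -/
noncomputable def unitaryToCircle {B : Type*} [CommCStarAlgebra B]
    (χ : WeakDual.characterSpace ℂ B) : unitary B →* Circle where
  toFun x := ⟨χ (x : B), by
    rw [Submonoid.unitSphere, Submonoid.mem_mk, Subsemigroup.mem_mk, mem_sphere_zero_iff_norm]
    have h : star (χ (x : B)) * χ (x : B) = 1 := by
      rw [← map_star, ← map_mul, Unitary.coe_star_mul_self, map_one]
    have h2 : ‖χ (x : B)‖ * ‖χ (x : B)‖ = 1 := by
      rw [← CStarRing.norm_star_mul_self, h, norm_one]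
    nlinarith [norm_nonneg (χ (x : B))]⟩
  map_one' := Circle.ext (by simp)
  map_mul' x y := Circle.ext (map_mul χ (x : B) y)

theorem coe_unitaryToCircle {B : Type*} [CommCStarAlgebra B] (χ : WeakDual.characterSpace ℂ B)
    (x : unitary B) : (unitaryToCircle χ x : ℂ) = χ (x : B) := rfl

/-- A commutative C*-algebra that is densely spanned by monomials in two unitaries, with joint
spectrum the whole torus, is the algebra of continuous functions on the torus. -/
theorem nonempty_starAlgEquiv_torus {B : Type*} [CommCStarAlgebra B] (x y : unitary B) (G : Set B)
    (hG : Dense (Submodule.span ℂ G : Set B))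
    (hxy : ∀ g ∈ G, ∃ i j : ℤ, g = ((x ^ i * y ^ j : unitary B) : B))
    (hsurj : ∀ z t : Circle, ∃ χ : B →ₐ[ℂ] ℂ, χ x = z ∧ χ y = t) :
    Nonempty (B ≃⋆ₐ[ℂ] C(Circle × Circle, ℂ)) := by
  let J : WeakDual.characterSpace ℂ B → Circle × Circle := fun χ =>
    (unitaryToCircle χ x, unitaryToCircle χ y)
  have hcont (b : B) : Continuous fun χ : WeakDual.characterSpace ℂ B => χ b :=
    (WeakDual.eval_continuous b).comp continuous_subtype_val
  have hJ : Continuous J := by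
    refine Continuous.prodMk ?_ ?_
    · exact Topology.IsInducing.subtypeVal.continuous_iff.2 (hcont x)
    · exact Topology.IsInducing.subtypeVal.continuous_iff.2 (hcont y)
  have hinj : Function.Injective J := by
    intro χ χ' h
    obtain ⟨h1, h2⟩ := Prod.ext_iff.1 h
    have key : ∀ g ∈ G, χ g = χ' g := by
      intro g hg
      obtain ⟨i, j, rfl⟩ := hxy g hg
      rw [← coe_unitaryToCircle, ← coe_unitaryToCircle, map_mul, map_mul, map_zpow, map_zpow,
        map_zpow, map_zpow]
      rw [show unitaryToCircle χ x = unitaryToCircle χ' x from h1,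
        show unitaryToCircle χ y = unitaryToCircle χ' y from h2]
    have key2 : Set.EqOn χ χ' (Submodule.span ℂ G : Set B) := by
      intro b hb
      refine Submodule.span_induction (p := fun b _ => χ b = χ' b) key ?_ ?_ ?_ hb
      · simp
      · intro a b _ _ h1 h2; simp [h1, h2]
      · intro r a _ h1; simp [h1]
    have h3 : (χ : B → ℂ) = χ' :=
      Continuous.ext_on hG (map_continuous χ) (map_continuous χ') key2
    exact DFunLike.coe_injective h3
  have hbij : Function.Bijective J := by
    refine ⟨hinj, fun ⟨z, t⟩ => ?_⟩
    obtain ⟨χ, h1, h2⟩ := hsurj z t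
    exact ⟨WeakDual.CharacterSpace.equivAlgHom.symm χ, Prod.ext (Circle.ext h1) (Circle.ext h2)⟩
  let e : WeakDual.characterSpace ℂ B ≃ₜ Circle × Circle :=
    Continuous.homeoOfEquivCompactToT2 (f := Equiv.ofBijective J hbij) hJ
  exact ⟨(gelfandStarTransform B).trans (e.compStarAlgEquiv' ℂ ℂ).symm⟩

theorem exists_zpow_eq (z : Circle) {n : ℤ} (hn : n ≠ 0) : ∃ t : Circle, t ^ n = z := by
  obtain ⟨θ, rfl⟩ := Circle.exp_surjective z
  refine ⟨Circle.exp (θ / n), ?_⟩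
  have hn' : (n : ℝ) ≠ 0 := Int.cast_ne_zero.2 hn
  rw [← Circle.exp_zsmul, zsmul_eq_mul, mul_div_cancel₀ _ hn']

/-- A subgroup of `ℤ²` of finite index has a basis in triangular form. -/
theorem exists_triangular_basis (L : AddSubgroup (ℤ × ℤ)) {a b : ℤ} (ha : a ≠ 0) (hb : b ≠ 0)
    (hLa : (a, 0) ∈ L) (hLb : (0, b) ∈ L) :
    ∃ m n c : ℤ, m ≠ 0 ∧ c ≠ 0 ∧ (m, n) ∈ L ∧ (0, c) ∈ L ∧
      ∀ x ∈ L, ∃ i j : ℤ, x = i • (m, n) + j • (0, c) := by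
  obtain ⟨m, hm⟩ := Int.subgroup_cyclic (L.map (AddMonoidHom.fst ℤ ℤ))
  obtain ⟨c, hc⟩ := Int.subgroup_cyclic (L.comap (AddMonoidHom.inr ℤ ℤ))
  have hm1 : m ∈ L.map (AddMonoidHom.fst ℤ ℤ) := by
    rw [hm]; exact AddSubgroup.mem_closure_singleton_self m
  obtain ⟨⟨m', n⟩, hmn, rfl : m' = m⟩ := hm1
  have hc1 : c ∈ L.comap (AddMonoidHom.inr ℤ ℤ) := by
    rw [hc]; exact AddSubgroup.mem_closure_singleton_self c
  refine ⟨m', n, c, ?_, ?_, hmn, hc1, ?_⟩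
  · rintro rfl
    have : a ∈ L.map (AddMonoidHom.fst ℤ ℤ) := ⟨_, hLa, rfl⟩
    rw [hm, AddSubgroup.mem_closure_singleton] at this
    obtain ⟨t, ht⟩ := this
    exact ha (by simpa using ht.symm)
  · rintro rfl
    have : b ∈ L.comap (AddMonoidHom.inr ℤ ℤ) := hLb
    rw [hc, AddSubgroup.mem_closure_singleton] at this
    obtain ⟨t, ht⟩ := this
    exact hb (by simpa using ht.symm)
  · rintro ⟨x1, x2⟩ hx
    have h1 : x1 ∈ L.map (AddMonoidHom.fst ℤ ℤ) := ⟨_, hx, rfl⟩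
    rw [hm, AddSubgroup.mem_closure_singleton] at h1
    obtain ⟨i, hi⟩ := h1
    have h2 : x2 - i • n ∈ L.comap (AddMonoidHom.inr ℤ ℤ) := by
      have := L.sub_mem hx (L.zsmul_mem hmn i)
      have he : (x1, x2) - i • (m', n) = (AddMonoidHom.inr ℤ ℤ) (x2 - i • n) := by
        ext
        · simpa [sub_eq_zero] using hi.symm
        · simp
      rw [he] at this
      exact this
    rw [hc, AddSubgroup.mem_closure_singleton] at h2
    obtain ⟨j, hj⟩ := h2
    refine ⟨i, j, Prod.ext ?_ ?_⟩
    · simpa using hi.symm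
    · simp only [Prod.snd_add, Prod.smul_snd]
      rw [hj]; ring

end Torus

/-! ### Corners -/

section Corner

variable {A : Type*} [NonUnitalCStarAlgebra A] {p : A} (hp : IsStarProjection p)
include hp

theorem mem_cornerSubalgebra_iff {a : A} : a ∈ cornerSubalgebra p hp ↔ p * a * p = a := by
  constructor
  · rintro ⟨b, rfl⟩
    simp only [mul_assoc, hp.isIdempotentElem.eq]
    simp only [← mul_assoc, hp.isIdempotentElem.eq]
  · intro h
    exact ⟨a, h⟩

theorem mul_eq_of_mem_corner {a : A} (ha : a ∈ cornerSubalgebra p hp) : p * a = a := by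
  rw [mem_cornerSubalgebra_iff] at ha
  rw [← ha]
  simp only [← mul_assoc, hp.isIdempotentElem.eq]

theorem eq_mul_of_mem_corner {a : A} (ha : a ∈ cornerSubalgebra p hp) : a * p = a := by
  rw [mem_cornerSubalgebra_iff] at ha
  rw [← ha]
  simp only [mul_assoc, hp.isIdempotentElem.eq]

theorem isClosed_cornerSubalgebra : IsClosed (cornerSubalgebra p hp : Set A) := by
  have : (cornerSubalgebra p hp : Set A) = {a | p * a * p = a} := by
    ext a
    exact mem_cornerSubalgebra_iff hp
  rw [this]
  exact isClosed_eq (by fun_prop) continuous_id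

theorem mem_corner_self : p ∈ cornerSubalgebra p hp := by
  rw [mem_cornerSubalgebra_iff, hp.isIdempotentElem.eq, hp.isIdempotentElem.eq]

/-- A commutative corner `pAp` is a commutative C*-algebra with unit `p`. -/
@[reducible] noncomputable def cornerCommCStarAlgebra
    (hcomm : ∀ a ∈ cornerSubalgebra p hp, ∀ b ∈ cornerSubalgebra p hp, a * b = b * a) :
    CommCStarAlgebra (cornerSubalgebra p hp) :=
  let base : NonUnitalCStarAlgebra (cornerSubalgebra p hp) :=
    NonUnitalStarSubalgebra.nonUnitalCStarAlgebra _ (h_closed := isClosed_cornerSubalgebra hp)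
  let ring : NormedRing (cornerSubalgebra p hp) :=
    { base.toNonUnitalNormedRing with
      one := ⟨p, mem_corner_self hp⟩
      one_mul := fun a => Subtype.ext (mul_eq_of_mem_corner hp a.2)
      mul_one := fun a => Subtype.ext (eq_mul_of_mem_corner hp a.2) }
  let alg : Algebra ℂ (cornerSubalgebra p hp) :=
    Algebra.ofModule (fun r a b => smul_mul_assoc r a b) (fun r a b => mul_smul_comm r a b)
  { ring, base with
    toAlgebra := alg
    mul_comm := fun a b => Subtype.ext (hcomm a a.2 b b.2)
    norm_smul_le := fun r a => norm_smul_le r a }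

end Corner

namespace KGraph

/-! ### The corner at a periodic vertex -/

section CornerAlgebra

variable {k : ℕ} {V : Type u} [Category.{v} V] {Λ : KGraph k V} {v : V}

variable (Λ v) in
/-- The elements `s_α s_β^*` with `α, β` closed paths at `v`. -/
def closedElements : Set Λ.CStar :=
  {x | ∃ α β : v ⟶ v, x = Λ.universalFamily.S α * star (Λ.universalFamily.S β)}

/-- The corner at `v` is the closed span of the elements `s_α s_β^*` with `α, β` closed paths at
`v`. -/
theorem corner_subset_closure (h : Λ.IsPeriodicVertex v) (hrow : Λ.RowFinite) (hsrc : Λ.NoSources)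
    {x : Λ.CStar} (hx : x ∈ cornerSubalgebra (Λ.p v) (Λ.isStarProjection_p v)) :
    x ∈ closure (Submodule.span ℂ (Λ.closedElements v) : Set Λ.CStar) := by
  set F := Λ.universalFamily
  rw [mem_cornerSubalgebra_iff] at hx
  rw [← hx]
  have hcont : Continuous fun a : Λ.CStar => Λ.p v * a * Λ.p v := by fun_prop
  refine map_mem_closure (f := fun a => Λ.p v * a * Λ.p v) hcont
    (dense_span_S_mul_star h hrow hsrc x) ?_
  intro a ha
  refine Submodule.span_induction (p := fun a _ => Λ.p v * a * Λ.p v ∈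
    Submodule.span ℂ (Λ.closedElements v)) ?_ ?_ ?_ ?_ ha
  · rintro _ ⟨b, c, f, g, rfl⟩
    have hassoc : Λ.p v * (F.S f * star (F.S g)) * Λ.p v =
        (F.S (𝟙 v) * F.S f) * star (F.S (𝟙 v) * F.S g) := by
      rw [star_mul, F.star_S_id]
      simp only [mul_assoc]
      rfl
    rw [hassoc]
    have hz : ∀ {b : V} (f : v ⟶ b), v ≠ b → F.S (𝟙 v) * F.S f = 0 := fun f hb => by
      rw [← F.id_mul_S f, ← mul_assoc, F.orthogonal _ _ hb, zero_mul]
    by_cases hb : v = b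
    · by_cases hc : v = c
      · subst hb hc
        rw [F.id_mul_S, F.id_mul_S]
        exact Submodule.subset_span ⟨f, g, rfl⟩
      · rw [hz g hc, star_zero, mul_zero]
        exact zero_mem _
    · rw [hz f hb, zero_mul]
      exact zero_mem _
  · simp
  · intro a b _ _ h1 h2
    rw [mul_add, add_mul]
    exact add_mem h1 h2
  · intro r a _ h1
    rw [mul_smul_comm, smul_mul_assoc]
    exact Submodule.smul_mem _ _ h1

theorem closedElements_subset_corner :
    Λ.closedElements v ⊆ cornerSubalgebra (Λ.p v) (Λ.isStarProjection_p v) := by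
  rintro _ ⟨α, β, rfl⟩
  set F := Λ.universalFamily
  refine (mem_cornerSubalgebra_iff _).2 ?_
  change F.S (𝟙 v) * (F.S α * star (F.S β)) * F.S (𝟙 v) = _
  rw [← mul_assoc, F.id_mul_S, mul_assoc, F.star_S_mul_id]

theorem closedElements_comm (h : Λ.IsPeriodicVertex v) {x y : Λ.CStar}
    (hx : x ∈ Λ.closedElements v) (hy : y ∈ Λ.closedElements v) : x * y = y * x := by
  obtain ⟨α, β, rfl⟩ := hx
  obtain ⟨γ, δ, rfl⟩ := hy
  set F := Λ.universalFamily
  have h1 : ∀ α β γ δ : v ⟶ v, F.S α * star (F.S β) * (F.S γ * star (F.S δ)) =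
      F.S (γ ≫ α) * star (F.S (β ≫ δ)) := fun α β γ δ => by
    rw [mul_assoc, ← mul_assoc (star (F.S β)), F.star_S_closed_comm h, ← F.mul, ← F.mul, star_mul]
    simp only [mul_assoc]
  rw [h1, h1, h.comp_comm γ α, h.comp_comm β δ]

theorem corner_comm (h : Λ.IsPeriodicVertex v) (hrow : Λ.RowFinite) (hsrc : Λ.NoSources) :
    ∀ a ∈ cornerSubalgebra (Λ.p v) (Λ.isStarProjection_p v),
      ∀ b ∈ cornerSubalgebra (Λ.p v) (Λ.isStarProjection_p v), a * b = b * a := by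
  intro a ha b hb
  have h1 : ∀ x ∈ Submodule.span ℂ (Λ.closedElements v),
      ∀ y ∈ Submodule.span ℂ (Λ.closedElements v), x * y = y * x := by
    intro x hx y hy
    refine Submodule.span_induction₂ (p := fun x y _ _ => x * y = y * x) ?_ ?_ ?_ ?_ ?_ ?_ ?_ hx hy
    · intro x y hx hy; exact closedElements_comm h hx hy
    · intro y _; simp
    · intro x _; simp
    · intro x y z _ _ _ h1 h2; rw [add_mul, mul_add, h1, h2]
    · intro x y z _ _ _ h1 h2; rw [add_mul, mul_add, h1, h2]
    · intro r x y _ _ h; rw [smul_mul_assoc, mul_smul_comm, h]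
    · intro r x y _ _ h; rw [smul_mul_assoc, mul_smul_comm, h]
  have h2 : (a, b) ∈ closure ((Submodule.span ℂ (Λ.closedElements v) : Set Λ.CStar) ×ˢ
      (Submodule.span ℂ (Λ.closedElements v) : Set Λ.CStar)) := by
    rw [closure_prod_eq]
    exact ⟨corner_subset_closure h hrow hsrc ha, corner_subset_closure h hrow hsrc hb⟩
  have hcl : IsClosed {z : Λ.CStar × Λ.CStar | z.1 * z.2 = z.2 * z.1} :=
    isClosed_eq (by fun_prop) (by fun_prop)
  exact closure_minimal (fun z hz => h1 z.1 hz.1 z.2 hz.2) hcl h2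

/-- The scalars as operators on `ℂ`. -/
noncomputable def scalarRep : ℂ →⋆ₙₐ[ℂ] (ℂ →L[ℂ] ℂ) :=
  (StarAlgHom.ofId ℂ (ℂ →L[ℂ] ℂ) : ℂ →⋆ₙₐ[ℂ] (ℂ →L[ℂ] ℂ))

theorem scalarRep_injective : Function.Injective scalarRep :=
  (algebraMap ℂ (ℂ →L[ℂ] ℂ)).injective

/-- The representation of `C*(Λ)` on the infinite paths, twisted by the character `c` of the
degree: on the corner at `v` it is scalar, because `v` receives only one infinite path. -/
theorem exists_scalar_representation (h : Λ.IsPeriodicVertex v) (hrow : Λ.RowFinite)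
    (c : Fin k → Circle) :
    ∃ (D : Type) (_ : NonUnitalCStarAlgebra D) (ι : Type) (E : MatrixSystem ι ℂ D) (i : ι)
      (ρ : Λ.CStar →⋆ₙₐ[ℂ] D),
      ∀ α : v ⟶ v, ρ (Λ.universalFamily.S α) = E.e i i (degreeChar c (Λ.d α)) := by
  have := h.countable_sigma_tailClass
  obtain ⟨ν, hν⟩ := exists_injective_nat (Σ w : V, h.TailClass w)
  let E := operatorMatrixSystem ℕ scalarRep scalarRep_injective
  let F := h.pathFamily hrow c (E.reindex ν hν)
  exact ⟨_, inferInstance, ℕ, E, ν ⟨v, h.tail (𝟙 v)⟩, F.lift,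
    fun α => h.pathFamily_S_closed hrow c (E.reindex ν hν) α⟩

/-- For each character `c` of the degree the corner has a character with
`s_α s_β^* ↦ c^{d(α)} c^{-d(β)}`. -/
theorem exists_corner_character (h : Λ.IsPeriodicVertex v) (hrow : Λ.RowFinite) (hsrc : Λ.NoSources)
    (c : Fin k → Circle) :
    letI := cornerCommCStarAlgebra (Λ.isStarProjection_p v) (corner_comm h hrow hsrc)
    ∃ χ : cornerSubalgebra (Λ.p v) (Λ.isStarProjection_p v) →ₐ[ℂ] ℂ,
      ∀ (α β : v ⟶ v) (x : cornerSubalgebra (Λ.p v) (Λ.isStarProjection_p v)),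
        (x : Λ.CStar) = Λ.universalFamily.S α * star (Λ.universalFamily.S β) →
          χ x = degreeChar c (Λ.d α) * star (degreeChar c (Λ.d β)) := by
  let _ := cornerCommCStarAlgebra (Λ.isStarProjection_p v) (corner_comm h hrow hsrc)
  obtain ⟨D, _, ι, E, i, ρ, hρ⟩ := exists_scalar_representation h hrow c
  have hval : ∀ α β : v ⟶ v, ρ (Λ.universalFamily.S α * star (Λ.universalFamily.S β)) =
      E.e i i (degreeChar c (Λ.d α) * star (degreeChar c (Λ.d β))) := fun α β => by
    rw [map_mul, map_star, hρ, hρ, E.star_e, E.mul_same]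
  have hρc : Continuous ρ :=
    AddMonoidHomClass.continuous_of_bound ρ 1 fun x => by
      simpa using NonUnitalStarAlgHom.norm_apply_le ρ x
  have hcl : IsClosed (Set.range (E.e i i)) :=
    (AddMonoidHomClass.isometry_of_norm (E.e i i) (E.norm_e i i)).isClosedEmbedding.isClosed_range
  have hex : ∀ x : cornerSubalgebra (Λ.p v) (Λ.isStarProjection_p v), ∃ z, E.e i i z = ρ x := by
    intro x
    have hsub : (Submodule.span ℂ (Λ.closedElements v) : Set Λ.CStar) ⊆ ρ ⁻¹' Set.range (E.e i i) := by
      have : Submodule.span ℂ (Λ.closedElements v) ≤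
          (LinearMap.range (E.e i i)).comap (ρ : Λ.CStar →ₗ[ℂ] D) := by
        rw [Submodule.span_le]
        rintro _ ⟨α, β, rfl⟩
        exact ⟨_, (hval α β).symm⟩
      exact this
    exact closure_minimal hsub (hcl.preimage hρc) (corner_subset_closure h hrow hsrc x.2)
  choose z hz using hex
  have hinj := E.injective i i
  refine ⟨AlgHom.ofLinearMap
    { toFun := z
      map_add' := fun x y => hinj ?_
      map_smul' := fun r x => hinj ?_ } (hinj ?_) (fun x y => hinj ?_), fun α β x hx => hinj ?_⟩
  · rw [hz, map_add, hz, hz]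
    exact map_add ρ (x : Λ.CStar) y
  · rw [hz, map_smul, hz]
    exact map_smul ρ r (x : Λ.CStar)
  · change E.e i i (z 1) = _
    rw [hz]
    have : ρ (Λ.universalFamily.S (𝟙 v)) = _ := hρ (𝟙 v)
    rw [Λ.d_id, degreeChar_zero] at this
    exact this
  · change E.e i i (z (x * y)) = E.e i i (z x * z y)
    rw [hz, ← E.mul_same i i i, hz, hz]
    exact map_mul ρ (x : Λ.CStar) y
  · change E.e i i (z x) = _
    rw [hz, hx, hval]

end CornerAlgebra

end KGraph

namespace KGraph

/-! ### The corner of a `2`-graph -/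

section TwoGraph

variable {V : Type u} [Category.{v} V] {Λ : KGraph 2 V} {v : V}

variable (Λ) in
/-- The degree of a path of a `2`-graph as an element of `ℤ²`. -/
def intDegree {w v : V} (f : w ⟶ v) : ℤ × ℤ := (Λ.d f 0, Λ.d f 1)

theorem intDegree_comp {u w v : V} (ν : u ⟶ w) (μ : w ⟶ v) :
    Λ.intDegree (ν ≫ μ) = Λ.intDegree μ + Λ.intDegree ν := by
  simp [intDegree, Λ.d_comp]

theorem intDegree_id (v : V) : Λ.intDegree (𝟙 v) = 0 := by
  simp [intDegree, Λ.d_id]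

theorem d_eq_of_intDegree_eq {w v w' v' : V} {f : w ⟶ v} {g : w' ⟶ v'}
    (h : Λ.intDegree f = Λ.intDegree g) : Λ.d f = Λ.d g := by
  obtain ⟨h0, h1⟩ := Prod.ext_iff.1 h
  funext i
  fin_cases i
  · exact Int.natCast_inj.1 h0
  · exact Int.natCast_inj.1 h1

variable (Λ v) in
/-- The group of periods of the infinite path at `v`: the differences of the degrees of closed
paths. -/
def periodGroup : AddSubgroup (ℤ × ℤ) where
  carrier := {m | ∃ α β : v ⟶ v, Λ.intDegree α - Λ.intDegree β = m}
  zero_mem' := ⟨𝟙 v, 𝟙 v, sub_self _⟩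
  add_mem' := by
    rintro _ _ ⟨α, β, rfl⟩ ⟨γ, δ, rfl⟩
    refine ⟨α ≫ γ, β ≫ δ, ?_⟩
    rw [intDegree_comp, intDegree_comp]
    abel
  neg_mem' := by
    rintro _ ⟨α, β, rfl⟩
    exact ⟨β, α, (neg_sub _ _).symm⟩

theorem degreeChar_mul_star_eq (c : Fin 2 → Circle) {α β : v ⟶ v} {m n : ℤ}
    (h : Λ.intDegree α - Λ.intDegree β = (m, n)) :
    degreeChar c (Λ.d α) * star (degreeChar c (Λ.d β)) = ((c 0 ^ m * c 1 ^ n : Circle) : ℂ) := by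
  obtain ⟨rfl, rfl⟩ := Prod.ext_iff.1 h
  have : star (degreeChar c (Λ.d β)) = ((∏ i, c i ^ Λ.d β i : Circle)⁻¹ : Circle) := by
    rw [Circle.coe_inv_eq_conj]; rfl
  rw [this, degreeChar, ← Circle.coe_mul]
  congr 1
  simp only [Fin.prod_univ_two, intDegree, Prod.fst_sub, Prod.snd_sub, zpow_sub, zpow_natCast,
    mul_inv]
  exact mul_mul_mul_comm _ _ _ _

/-- The corner at a periodic vertex of a `2`-graph whose periods have finite index in `ℤ²` is
`C(𝕋²)`.  It is spanned by a unitary representation of the group of periods, hence by monomials in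
the two unitaries that belong to a basis of this group, and the twisted path representations
realise all values of these unitaries. -/
theorem nonempty_corner_equiv (h : Λ.IsPeriodicVertex v) (hrow : Λ.RowFinite) (hsrc : Λ.NoSources)
    {a b : ℤ} (ha : a ≠ 0) (hb : b ≠ 0) (hLa : (a, 0) ∈ Λ.periodGroup v)
    (hLb : (0, b) ∈ Λ.periodGroup v) :
    Nonempty (cornerSubalgebra (Λ.p v) (Λ.isStarProjection_p v) ≃⋆ₐ[ℂ] C(Circle × Circle, ℂ)) := by
  let _ := cornerCommCStarAlgebra (Λ.isStarProjection_p v) (corner_comm h hrow hsrc)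
  set F := Λ.universalFamily with hF
  have hmem : ∀ α : v ⟶ v, F.S α ∈ cornerSubalgebra (Λ.p v) (Λ.isStarProjection_p v) := fun α =>
    closedElements_subset_corner ⟨α, 𝟙 v, by rw [F.star_S_id, F.S_mul_id]⟩
  let κ : (v ⟶ v) → unitary (cornerSubalgebra (Λ.p v) (Λ.isStarProjection_p v)) := fun α =>
    ⟨⟨F.S α, hmem α⟩, Subtype.ext (F.star_mul_self α), Subtype.ext (F.closed_mul_star h α)⟩
  have hκ : ∀ α β, κ α * κ β = κ (β ≫ α) := fun α β =>
    Subtype.ext (Subtype.ext (F.mul α β))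
  have hκdiv : ∀ α β, (((κ α / κ β : unitary _) :
      cornerSubalgebra (Λ.p v) (Λ.isStarProjection_p v)) : Λ.CStar) = F.S α * star (F.S β) :=
    fun α β => by rw [div_eq_mul_inv]; rfl
  have hwd : ∀ α β α' β' : v ⟶ v, Λ.intDegree α - Λ.intDegree β = Λ.intDegree α' - Λ.intDegree β' →
      κ α / κ β = κ α' / κ β' := by
    intro α β α' β' he
    rw [div_eq_div_iff_mul_eq_mul, hκ, hκ]
    congr 1
    have hd : Λ.d (β' ≫ α) = Λ.d (β ≫ α') := by
      apply d_eq_of_intDegree_eq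
      rw [intDegree_comp, intDegree_comp]
      exact sub_eq_sub_iff_add_eq_add.1 he
    have := h.eq_of_d_eq hd
    simpa using this
  choose α β hαβ using fun m : Λ.periodGroup v => m.2
  let R : Λ.periodGroup v →+ Additive (unitary (cornerSubalgebra (Λ.p v) (Λ.isStarProjection_p v))) :=
    { toFun := fun m => Additive.ofMul (κ (α m) / κ (β m))
      map_zero' := by
        have := hwd (α 0) (β 0) (𝟙 v) (𝟙 v) (by rw [hαβ, sub_self]; rfl)
        rw [this, div_self']; rfl
      map_add' := fun m n => by
        have := hwd (α (m + n)) (β (m + n)) (α n ≫ α m) (β n ≫ β m) (by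
          rw [hαβ, intDegree_comp, intDegree_comp, add_sub_add_comm, hαβ, hαβ]; rfl)
        rw [this, ← hκ, ← hκ, mul_div_mul_comm]; rfl }
  have hR : ∀ (γ δ : v ⟶ v) (m : Λ.periodGroup v), Λ.intDegree γ - Λ.intDegree δ = m →
      κ γ / κ δ = (R m).toMul := fun γ δ m hm => hwd _ _ _ _ (hm.trans (hαβ m).symm)
  obtain ⟨m, n, c, hm, hc, hmn, hc', hbasis⟩ := exists_triangular_basis _ ha hb hLa hLb
  let x := (R ⟨_, hmn⟩).toMul
  let y := (R ⟨_, hc'⟩).toMul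
  refine nonempty_starAlgEquiv_torus x y (Subtype.val ⁻¹' Λ.closedElements v) ?_ ?_ ?_
  · intro z
    have hz := corner_subset_closure h hrow hsrc z.2
    rw [closure_subtype]
    refine closure_mono ?_ hz
    have hle : Submodule.span ℂ (Λ.closedElements v) ≤
        (Submodule.span ℂ (Subtype.val ⁻¹' Λ.closedElements v :
          Set (cornerSubalgebra (Λ.p v) (Λ.isStarProjection_p v)))).map
            (NonUnitalStarSubalgebraClass.subtype
              (cornerSubalgebra (Λ.p v) (Λ.isStarProjection_p v)) :
                cornerSubalgebra (Λ.p v) (Λ.isStarProjection_p v) →ₗ[ℂ] Λ.CStar) := by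
      rw [Submodule.span_le]
      intro x hx
      exact ⟨⟨x, closedElements_subset_corner hx⟩, Submodule.subset_span hx, rfl⟩
    exact hle
  · rintro ⟨g, hg'⟩ ⟨γ, δ, hg⟩
    obtain ⟨i, j, hij⟩ := hbasis (Λ.intDegree γ - Λ.intDegree δ) ⟨γ, δ, rfl⟩
    refine ⟨i, j, Subtype.ext (hg.trans ?_)⟩
    have h1 := hR γ δ (i • ⟨_, hmn⟩ + j • ⟨_, hc'⟩) (by rw [hij]; rfl)
    rw [map_add, map_zsmul, map_zsmul] at h1
    rw [← hκdiv γ δ, h1]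
    rfl
  · intro z t
    obtain ⟨w₁, hw₁⟩ := exists_zpow_eq t hc
    obtain ⟨w₀, hw₀⟩ := exists_zpow_eq (z * (w₁ ^ n)⁻¹) hm
    obtain ⟨χ, hχ⟩ := exists_corner_character h hrow hsrc ![w₀, w₁]
    refine ⟨χ, ?_, ?_⟩
    · rw [hχ (α ⟨_, hmn⟩) (β ⟨_, hmn⟩) x (hκdiv _ _),
        degreeChar_mul_star_eq ![w₀, w₁] (hαβ ⟨_, hmn⟩)]
      simp [hw₀]
    · rw [hχ (α ⟨_, hc'⟩) (β ⟨_, hc'⟩) y (hκdiv _ _),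
        degreeChar_mul_star_eq ![w₀, w₁] (hαβ ⟨_, hc'⟩)]
      simp [hw₁]

end TwoGraph

/-! ### Matrices over the corner -/

section MatrixOverCorner

variable {k : ℕ} {V : Type u} [Category.{v} V] {Λ : KGraph k V} {v : V}

theorem isFullElement_p (h : Λ.IsPeriodicVertex v) (hrow : Λ.RowFinite) (hsrc : Λ.NoSources) :
    IsFullElement (Λ.p v) := by
  refine (dense_span_S_mul_star h hrow hsrc).mono (Submodule.span_mono ?_)
  rintro _ ⟨a, b, f, g, rfl⟩
  exact ⟨_, _, congrArg (· * _) (Λ.universalFamily.S_mul_id f).symm⟩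

/-- For representatives `f_x` of the infinite paths `x`, the elements `s_{f_x} a s_{f_y}^*` with
`a` in the corner at `v` are elementary matrices that densely span `C*(Λ)`. -/
theorem exists_matrixSystem (h : Λ.IsPeriodicVertex v) (hrow : Λ.RowFinite) (hsrc : Λ.NoSources)
    {C : Type w} [NonUnitalCStarAlgebra C]
    (θ : C ≃⋆ₐ[ℂ] cornerSubalgebra (Λ.p v) (Λ.isStarProjection_p v)) :
    ∃ M : MatrixSystem (Σ w : V, h.TailClass w) C Λ.CStar, M.IsDense := by
  set F := Λ.universalFamily with hF
  choose f hf using fun x : Σ w : V, h.TailClass w => h.tail_surjective x.2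
  have hf' : ∀ x : Σ w : V, h.TailClass w,
      (⟨x.1, h.tail (f x)⟩ : Σ w : V, h.TailClass w) = x := fun x => by rw [hf]
  have hl : ∀ a : C, F.S (𝟙 v) * (θ a : Λ.CStar) = θ a := fun a =>
    mul_eq_of_mem_corner (Λ.isStarProjection_p v) (θ a).2
  have hr : ∀ a : C, (θ a : Λ.CStar) * F.S (𝟙 v) = θ a := fun a =>
    eq_mul_of_mem_corner (Λ.isStarProjection_p v) (θ a).2
  have hassoc : ∀ (x y y' z : Σ w : V, h.TailClass w) (a b : C),
      F.S (f x) * (θ a : Λ.CStar) * star (F.S (f y)) *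
        (F.S (f y') * (θ b : Λ.CStar) * star (F.S (f z))) =
      F.S (f x) * ((θ a : Λ.CStar) * (star (F.S (f y)) * F.S (f y')) * θ b) * star (F.S (f z)) := by
    intros
    simp only [mul_assoc]
  let M : MatrixSystem (Σ w : V, h.TailClass w) C Λ.CStar :=
    { e := fun x y =>
        { toFun := fun a => F.S (f x) * (θ a : Λ.CStar) * star (F.S (f y))
          map_add' := fun a b => by
            rw [map_add, ← add_mul, ← mul_add]; rfl
          map_smul' := fun r a => by
            rw [map_smul, RingHom.id_apply, ← smul_mul_assoc, ← mul_smul_comm]; rfl }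
      mul_same := fun x y z a b => by
        change F.S (f x) * (θ a : Λ.CStar) * star (F.S (f y)) *
          (F.S (f y) * (θ b : Λ.CStar) * star (F.S (f z))) = _
        rw [hassoc, F.star_mul_self, hr]
        change _ = F.S (f x) * (θ (a * b) : Λ.CStar) * star (F.S (f z))
        rw [map_mul]
        rfl
      mul_ne := fun x y y' z a b hy => by
        change F.S (f x) * (θ a : Λ.CStar) * star (F.S (f y)) *
          (F.S (f y') * (θ b : Λ.CStar) * star (F.S (f z))) = 0
        rw [hassoc, F.star_S_mul_S_of_tail_ne h hrow hsrc (by rwa [hf', hf'])]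
        simp
      star_e := fun x y a => by
        change star (F.S (f x) * (θ a : Λ.CStar) * star (F.S (f y))) =
          F.S (f y) * (θ (star a) : Λ.CStar) * star (F.S (f x))
        rw [star_mul, star_mul, star_star, map_star, ← mul_assoc]
        rfl
      injective := fun x y a b hab => by
        have hcomp : ∀ a : C, star (F.S (f x)) * (F.S (f x) * (θ a : Λ.CStar) * star (F.S (f y))) *
            F.S (f y) = θ a := fun a => by
          rw [← mul_assoc, ← mul_assoc, F.star_mul_self, mul_assoc, F.star_mul_self, hl, hr]
        exact θ.injective (Subtype.ext ((hcomp a).symm.trans ((congrArg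
          (fun t => star (F.S (f x)) * t * F.S (f y)) hab).trans (hcomp b)))) }
  refine ⟨M, (dense_span_S_mul_star h hrow hsrc).mono (Submodule.span_mono ?_)⟩
  rintro _ ⟨b, c, g, g', rfl⟩
  -- `s_g = s_{f_x} s_β s_α^*` for the class `x` of `g` and suitable closed paths `α, β`
  have hrep : ∀ {b : V} (g : v ⟶ b), ∃ α β : v ⟶ v,
      F.S g = F.S (f ⟨b, h.tail g⟩) * (F.S β * star (F.S α)) := fun {b} g => by
    obtain ⟨α, β, hab⟩ := h.tail_eq_tail.1 (hf ⟨b, h.tail g⟩).symm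
    exact ⟨α, β, F.S_eq_of_comp_eq h hab⟩
  obtain ⟨α, β, h1⟩ := hrep g
  obtain ⟨γ, δ, h2⟩ := hrep g'
  have hz : F.S β * star (F.S α) * star (F.S δ * star (F.S γ)) ∈
      cornerSubalgebra (Λ.p v) (Λ.isStarProjection_p v) :=
    mul_mem (closedElements_subset_corner ⟨_, _, rfl⟩)
      (star_mem (closedElements_subset_corner ⟨_, _, rfl⟩))
  refine ⟨⟨b, h.tail g⟩, ⟨c, h.tail g'⟩, θ.symm ⟨_, hz⟩, ?_⟩
  change F.S g * star (F.S g') =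
    F.S (f ⟨b, h.tail g⟩) * (θ (θ.symm ⟨_, hz⟩) : Λ.CStar) * star (F.S (f ⟨c, h.tail g'⟩))
  rw [StarAlgEquiv.apply_symm_apply, h1, h2]
  simp only [star_mul, mul_assoc]

end MatrixOverCorner

end KGraph

namespace KGraph

/-! ### The periodic vertex of a pair of cycles without entrance -/

section Cycles

variable {V : Type u} [Category.{v} V] {Λ : KGraph 2 V} {v : V}

/-- A cycle without entrance of each colour yields a periodic vertex: cofinality provides a vertex
from which both cycles can be reached. -/
theorem exists_isPeriodicVertex (hrow : Λ.RowFinite) (hcof : Λ.Cofinal) (hsrc : Λ.NoSources)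
    (hblue : ∃ (a : V) (μ : a ⟶ a), Λ.IsCycle 0 μ ∧ Λ.HasNoEntrance 0 μ)
    (hred : ∃ (b : V) (ν : b ⟶ b), Λ.IsCycle 1 ν ∧ Λ.HasNoEntrance 1 ν) :
    ∃ (v : V) (ζ ξ : v ⟶ v), Λ.IsPeriodicVertex v ∧ Λ.IsCycle 0 ζ ∧ Λ.IsCycle 1 ξ := by
  obtain ⟨a, μ, hμ, hμ'⟩ := hblue
  obtain ⟨b, ν, hν, hν'⟩ := hred
  obtain ⟨x, hx⟩ := hsrc.exists_infinitePath a
  obtain ⟨n, ⟨q⟩⟩ := hcof b x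
  subst hx
  let p : x.vert n ⟶ x.vert 0 := x.path 0 n zero_le
  obtain ⟨-, hζ⟩ := single_edge_and_exists_closed hrow hsrc hμ hμ' p
  obtain ⟨-, hξ⟩ := single_edge_and_exists_closed hrow hsrc hν hν' q
  obtain ⟨ζ, hζ⟩ := exists_isCycle hζ
  obtain ⟨ξ, hξ⟩ := exists_isCycle hξ
  refine ⟨x.vert n, ζ, ξ, ⟨?_, ⟨ξ ≫ ζ, ?_⟩, hcof.exists_uniform hrow _⟩, hζ, hξ⟩
  · refine subsingleton_pathsFrom_of_edges fun w ⟨t⟩ i => ?_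
    fin_cases i
    · exact (single_edge_and_exists_closed hrow hsrc hμ hμ' (t ≫ p)).1
    · exact (single_edge_and_exists_closed hrow hsrc hν hν' (t ≫ q)).1
  · obtain ⟨⟨l, hl, hdζ⟩, -⟩ := hζ
    obtain ⟨⟨m, hm, hdξ⟩, -⟩ := hξ
    intro i
    rw [Λ.d_comp, hdζ, hdξ]
    fin_cases i
    · simp [basisDegree, hl]
    · simp [basisDegree, hm]

theorem IsPeriodicVertex.existsUnique_infinitePath (h : Λ.IsPeriodicVertex v) (hsrc : Λ.NoSources)
    (η : v ⟶ v) :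
    ∃ x : Λ.InfinitePath, x.IsInfinitePower η ∧ Λ.infinitePathsFrom v = {x} := by
  obtain ⟨x, hx⟩ := hsrc.exists_infinitePath v
  refine ⟨x, fun l => ?_, ?_⟩
  · have := h.subsingleton (l • Λ.d η)
    exact InfinitePath.arrow_initial_eq hx (Λ.d_closedPathPow η l)
  · refine Set.eq_singleton_iff_unique_mem.2 ⟨hx, fun y hy => InfinitePath.ext_of_initial fun n => ?_⟩
    subst hx
    have := h.subsingleton n
    exact InfinitePath.arrow_initial_eq hy (by rw [x.d_path, tsub_zero])

theorem IsPeriodicVertex.not_aperiodic (h : Λ.IsPeriodicVertex v) (hsrc : Λ.NoSources) :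
    ¬ Λ.Aperiodic := by
  intro hap
  obtain ⟨η, hη⟩ := h.exists_closed
  obtain ⟨x, -, hx⟩ := h.existsUnique_infinitePath hsrc η
  have hne : Λ.d η ≠ 0 := fun h0 => hη 0 (by rw [h0]; rfl)
  obtain ⟨y, hy, hyne⟩ := hap v (Λ.d η) 0 hne
  have hy0 : y.vert 0 = v := hy
  have h0 : ∀ z ∈ Λ.infinitePathsFrom v, z = x := fun z hz => by
    rw [hx] at hz
    exact hz
  apply hyne
  rw [h0 (y.shift (Λ.d η)), h0 (y.shift 0)]
  · change y.vert (0 + 0) = v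
    rw [add_zero, hy0]
  · change y.vert (0 + Λ.d η) = v
    rw [zero_add]
    have := h.subsingleton (Λ.d η)
    exact congrArg (fun f : Arrow V => f.left)
      (InfinitePath.arrow_initial_eq (x := y) hy0 (f := η) rfl)

/-- The kernel of the path representation is a nontrivial ideal: the untwisted representation does
not separate `s_ζ` from `p_v`, while a twisted one does. -/
theorem IsPeriodicVertex.not_isSimpleCStar (h : Λ.IsPeriodicVertex v) (hrow : Λ.RowFinite)
    {ζ : v ⟶ v} (hζ : Λ.IsCycle 0 ζ) : ¬ IsSimpleCStar Λ.CStar := by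
  rintro ⟨-, hsimple⟩
  obtain ⟨⟨l, hl, hd⟩, -⟩ := hζ
  obtain ⟨D, _, ι, E, i, ρ, hρ⟩ := exists_scalar_representation h hrow (fun _ => 1)
  have hchar : ∀ n : Fin 2 → ℕ, degreeChar (fun _ => 1) n = 1 := fun n => by simp [degreeChar]
  have hρc : Continuous ρ :=
    AddMonoidHomClass.continuous_of_bound ρ 1 fun x => by
      simpa using NonUnitalStarAlgHom.norm_apply_le ρ x
  have hcl : IsClosed (TwoSidedIdeal.ker ρ : Set Λ.CStar) := by
    have : (TwoSidedIdeal.ker ρ : Set Λ.CStar) = ρ ⁻¹' {0} := by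
      ext x
      exact TwoSidedIdeal.mem_ker ρ
    rw [this]
    exact isClosed_singleton.preimage hρc
  obtain hker | hker := hsimple _ hcl
  · rw [TwoSidedIdeal.ker_eq_bot] at hker
    have heq : Λ.universalFamily.S ζ = Λ.universalFamily.S (𝟙 v) := by
      apply hker
      rw [hρ, hρ, hchar, hchar]
    obtain ⟨t, ht⟩ := exists_zpow_eq (Circle.exp Real.pi) (Int.natCast_ne_zero.2 hl)
    obtain ⟨D', _, ι', E', i', ρ', hρ'⟩ := exists_scalar_representation h hrow ![t, 1]
    have h1 := congrArg ρ' heq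
    rw [hρ', hρ', Λ.d_id, degreeChar_zero, hd] at h1
    have h2 := E'.injective i' i' h1
    rw [zpow_natCast] at ht
    simp [degreeChar, basisDegree, Fin.prod_univ_two, ht, Circle.coe_exp] at h2
    norm_num at h2
  · have hp : Λ.universalFamily.S (𝟙 v) ∈ TwoSidedIdeal.ker ρ := by
      rw [hker]
      trivial
    rw [TwoSidedIdeal.mem_ker, hρ, hchar] at hp
    exact one_ne_zero (E.injective i i (hp.trans (map_zero _).symm))

end Cycles

end KGraph

theorem proposition6p1 {V : Type u} [Category.{v} V] (Λ : KGraph 2 V)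
    (hrow : Λ.RowFinite) (hcof : Λ.Cofinal) (hsrc : Λ.NoSources)
    (hblue : ∃ (a : V) (μ : a ⟶ a), Λ.IsCycle 0 μ ∧ Λ.HasNoEntrance 0 μ)
    (hred : ∃ (b : V) (ν : b ⟶ b), Λ.IsCycle 1 ν ∧ Λ.HasNoEntrance 1 ν) :
    (∃ (v : V) (ζ ξ : v ⟶ v),
      Λ.IsCycle 0 ζ ∧ Λ.IsCycle 1 ξ ∧
      (∃ x : Λ.InfinitePath, x.IsInfinitePower (ξ ≫ ζ) ∧ Λ.infinitePathsFrom v = {x}) ∧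
      Nonempty (cornerSubalgebra (Λ.p v) (Λ.isStarProjection_p v) ≃⋆ₐ[ℂ] C(Circle × Circle, ℂ)) ∧
      IsFullElement (Λ.p v)) ∧
    StablyIsomorphic Λ.CStar C(Circle × Circle, ℂ) ∧
    ¬ Λ.Aperiodic ∧
    AFEmbeddable Λ.CStar ∧
    ¬ IsSimpleCStar Λ.CStar := by
  obtain ⟨v, ζ, ξ, h, hζ, hξ⟩ := KGraph.exists_isPeriodicVertex hrow hcof hsrc hblue hred
  have hcorner : Nonempty
      (cornerSubalgebra (Λ.p v) (Λ.isStarProjection_p v) ≃⋆ₐ[ℂ] C(Circle × Circle, ℂ)) := by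
    obtain ⟨⟨l, hl, hdζ⟩, -⟩ := hζ
    obtain ⟨⟨m, hm, hdξ⟩, -⟩ := hξ
    refine KGraph.nonempty_corner_equiv h hrow hsrc (Int.natCast_ne_zero.2 hl) (Int.natCast_ne_zero.2 hm)
      ⟨ζ, 𝟙 v, ?_⟩ ⟨ξ, 𝟙 v, ?_⟩
    · rw [KGraph.intDegree_id, sub_zero]
      simp [KGraph.intDegree, hdζ, KGraph.basisDegree]
    · rw [KGraph.intDegree_id, sub_zero]
      simp [KGraph.intDegree, hdξ, KGraph.basisDegree]
  refine ⟨⟨v, ζ, ξ, hζ, hξ, h.existsUnique_infinitePath hsrc (ξ ≫ ζ), hcorner,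
    KGraph.isFullElement_p h hrow hsrc⟩, ?_⟩
  obtain ⟨θ⟩ := hcorner
  obtain ⟨M, hM⟩ := KGraph.exists_matrixSystem h hrow hsrc θ.symm
  have := h.countable_sigma_tailClass
  have : Nonempty (Σ w : V, h.TailClass w) := ⟨⟨v, h.tail (𝟙 v)⟩⟩
  exact ⟨M.stablyIsomorphic hM, h.not_aperiodic hsrc, M.afEmbeddable hM,
    h.not_isSimpleCStar hrow hζ⟩
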